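/- For a field $\mathbb{K}$ and $d\ge 2$ let $\mathbb{K}\langle X\rangle_d$ be the free associative $\mathbb{K}$-algebra without unity on the letters $x_1,\dots,x_d$ (its $\mathbb{K}$-basis is the set of non-empty words in these letters), and let $$N_{3,d}^{\mathbb{K}}=\mathbb{K}\langle X\rangle_d\,/\,\mathrm{id}\{x^3\mid x\in\mathbb{K}\langle X\rangle_d\},$$ where $\mathrm{id}$ denotes the two-sided algebra ideal generated by a set. Let $$C_{3,d}^{\mathbb{K}}=\min\{c>0\mid a_1\cdots a_c=0\text{ for all }a_1,\dots,a_c\in N_{3,d}^{\mathbb{K}}\}$$ be the nilpotency degree of $N_{3,d}^{\mathbb{K}}$. **Theorem 2.** Let $\mathbb{F}=\mathbb{F}_2$ be the field with two elements, let $\mathbb{L}$ be any infinite field of characteristic $2$, and let $d\ge 2$. Then: (a) $C_{3,d}^{\mathbb{F}}=C_{3,d}^{\mathbb{L}}$, and this number is $6$ if $d=2$ and $d+3$ if $d\ge 3$. (b) $N_{3,d}^{\mathbb{F}}$ and $N_{3,d}^{\mathbb{L}}$ are finite-dimensional, and $\dim_{\mathbb{F}} N_{3,d}^{\mathbb{F}}=\dim_{\mathbb{L}}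 N_{3,d}^{\mathbb{L}}+\dfrac{d(d-1)}{2}$. (c) $N_{3,d}^{\mathbb{L}}$ has an $\mathbb{L}$-basis consisting of (images of) words and containing none of the words $x_ix_jx_i$, $1\le i<j\le d$; and for every such set $B$ of words, $B\sqcup\{x_ix_jx_i\mid 1\le i<j\le d\}$ is an $\mathbb{F}$-basis of $N_{3,d}^{\mathbb{F}}$. -/

import Mathlib

/-- The algebra `𝔽⟨X⟩_d` without unity: the `𝔽`-vector space with basis the words (free semigroup) in
`d` letters, with multiplication extending concatenation. -/
abbrev FreeAlg (𝔽 : Type*) [Field 𝔽] (d : ℕ) : Type _ :=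
  MonoidAlgebra 𝔽 (FreeSemigroup (Fin d))

/-- The two-sided algebra ideal of `𝔽⟨X⟩_d` generated by all cubes `x ^ 3`, `x ∈ 𝔽⟨X⟩_d`: the
smallest linear subspace that contains all cubes and is closed under left and right multiplication
by arbitrary elements. -/
noncomputable def cubeIdeal (𝔽 : Type*) [Field 𝔽] (d : ℕ) : Submodule 𝔽 (FreeAlg 𝔽 d) :=
  sInf {J | (∀ x : FreeAlg 𝔽 d, x * x * x ∈ J) ∧
    ∀ a : FreeAlg 𝔽 d, ∀ f ∈ J, a * f ∈ J ∧ f * a ∈ J}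

theorem cubeIdeal_mul_left {𝔽 : Type*} [Field 𝔽] {d : ℕ} (a : FreeAlg 𝔽 d) {f : FreeAlg 𝔽 d}
    (hf : f ∈ cubeIdeal 𝔽 d) : a * f ∈ cubeIdeal 𝔽 d := by
  rw [cubeIdeal, Submodule.mem_sInf] at hf ⊢
  exact fun J hJ => (hJ.2 a f (hf J hJ)).1

theorem cubeIdeal_mul_right {𝔽 : Type*} [Field 𝔽] {d : ℕ} (a : FreeAlg 𝔽 d) {f : FreeAlg 𝔽 d}
    (hf : f ∈ cubeIdeal 𝔽 d) : f * a ∈ cubeIdeal 𝔽 d := by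
  rw [cubeIdeal, Submodule.mem_sInf] at hf ⊢
  exact fun J hJ => (hJ.2 a f (hf J hJ)).2

/-- The relatively free algebra `N_{3,d}` over `𝔽`. -/
def NilAlg (𝔽 : Type*) [Field 𝔽] (d : ℕ) : Type _ :=
  FreeAlg 𝔽 d ⧸ cubeIdeal 𝔽 d

namespace NilAlg

noncomputable instance (𝔽 : Type*) [Field 𝔽] (d : ℕ) : AddCommGroup (NilAlg 𝔽 d) :=
  inferInstanceAs (AddCommGroup (FreeAlg 𝔽 d ⧸ cubeIdeal 𝔽 d))

noncomputable instance (𝔽 : Type*) [Field 𝔽] (d : ℕ) : Module 𝔽 (NilAlg 𝔽 d) :=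
  inferInstanceAs (Module 𝔽 (FreeAlg 𝔽 d ⧸ cubeIdeal 𝔽 d))

/-- The canonical projection `𝔽⟨X⟩_d → N_{3,d}`. -/
noncomputable def mk (𝔽 : Type*) [Field 𝔽] (d : ℕ) : FreeAlg 𝔽 d →ₗ[𝔽] NilAlg 𝔽 d :=
  (cubeIdeal 𝔽 d).mkQ

theorem mk_surjective (𝔽 : Type*) [Field 𝔽] (d : ℕ) : Function.Surjective (mk 𝔽 d) :=
  (cubeIdeal 𝔽 d).mkQ_surjective

theorem mk_eq_mk {𝔽 : Type*} [Field 𝔽] {d : ℕ} {f g : FreeAlg 𝔽 d} :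
    mk 𝔽 d f = mk 𝔽 d g ↔ f - g ∈ cubeIdeal 𝔽 d :=
  Submodule.Quotient.eq (cubeIdeal 𝔽 d)

noncomputable instance (𝔽 : Type*) [Field 𝔽] (d : ℕ) : Mul (NilAlg 𝔽 d) where
  mul := Quotient.map₂ (fun f g : FreeAlg 𝔽 d => f * g) (by
    intro f f' hf g g' hg
    have hf' : f - f' ∈ cubeIdeal 𝔽 d := (Submodule.quotientRel_def _).1 hf
    have hg' : g - g' ∈ cubeIdeal 𝔽 d := (Submodule.quotientRel_def _).1 hg
    refine (Submodule.quotientRel_def _).2 ?_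
    have h : f * g - f' * g' = (f - f') * g + f' * (g - g') := by
      rw [sub_mul, mul_sub]; abel
    rw [h]
    exact add_mem (cubeIdeal_mul_right g hf') (cubeIdeal_mul_left f' hg'))

theorem mk_mul {𝔽 : Type*} [Field 𝔽] {d : ℕ} (f g : FreeAlg 𝔽 d) :
    mk 𝔽 d (f * g) = mk 𝔽 d f * mk 𝔽 d g := rfl

noncomputable instance (𝔽 : Type*) [Field 𝔽] (d : ℕ) : NonUnitalRing (NilAlg 𝔽 d) where
  left_distrib a b c := by
    obtain ⟨a, rfl⟩ := mk_surjective 𝔽 d a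
    obtain ⟨b, rfl⟩ := mk_surjective 𝔽 d b
    obtain ⟨c, rfl⟩ := mk_surjective 𝔽 d c
    rw [← map_add, ← mk_mul, mul_add, map_add, mk_mul, mk_mul]
  right_distrib a b c := by
    obtain ⟨a, rfl⟩ := mk_surjective 𝔽 d a
    obtain ⟨b, rfl⟩ := mk_surjective 𝔽 d b
    obtain ⟨c, rfl⟩ := mk_surjective 𝔽 d c
    rw [← map_add, ← mk_mul, add_mul, map_add, mk_mul, mk_mul]
  zero_mul a := by
    obtain ⟨a, rfl⟩ := mk_surjective 𝔽 d a
    rw [← map_zero (mk 𝔽 d), ← mk_mul, zero_mul]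
  mul_zero a := by
    obtain ⟨a, rfl⟩ := mk_surjective 𝔽 d a
    rw [← map_zero (mk 𝔽 d), ← mk_mul, mul_zero]
  mul_assoc a b c := by
    obtain ⟨a, rfl⟩ := mk_surjective 𝔽 d a
    obtain ⟨b, rfl⟩ := mk_surjective 𝔽 d b
    obtain ⟨c, rfl⟩ := mk_surjective 𝔽 d c
    rw [← mk_mul, ← mk_mul, ← mk_mul, ← mk_mul, mul_assoc]

instance (𝔽 : Type*) [Field 𝔽] (d : ℕ) : IsScalarTower 𝔽 (NilAlg 𝔽 d) (NilAlg 𝔽 d) where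
  smul_assoc c a b := by
    obtain ⟨a, rfl⟩ := mk_surjective 𝔽 d a
    obtain ⟨b, rfl⟩ := mk_surjective 𝔽 d b
    rw [smul_eq_mul, smul_eq_mul, ← map_smul, ← mk_mul, ← mk_mul, smul_mul_assoc, map_smul]

instance (𝔽 : Type*) [Field 𝔽] (d : ℕ) : SMulCommClass 𝔽 (NilAlg 𝔽 d) (NilAlg 𝔽 d) where
  smul_comm c a b := by
    obtain ⟨a, rfl⟩ := mk_surjective 𝔽 d a
    obtain ⟨b, rfl⟩ := mk_surjective 𝔽 d b
    rw [smul_eq_mul, smul_eq_mul, ← map_smul, ← mk_mul, ← mk_mul, mul_smul_comm, map_smul]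

/-- The image of a word in `N_{3,d}`. -/
noncomputable def word (𝔽 : Type*) [Field 𝔽] {d : ℕ} (w : FreeSemigroup (Fin d)) : NilAlg 𝔽 d :=
  mk 𝔽 d (MonoidAlgebra.single w 1)

end NilAlg

/-- The product `a 0 * a 1 * ⋯ * a k` of `k + 1` factors in a semigroup. -/
def consecProd {S : Type*} [Mul S] (a : ℕ → S) : ℕ → S
  | 0 => a 0
  | k + 1 => consecProd a k * a (k + 1)

/-- The nilpotency degree `C_{3,d}` over `𝔽`: the least `c > 0` such that every product of `c`
elements of `N_{3,d}` is zero (and `0` if there were no such `c`). -/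
noncomputable def nilDegree (𝔽 : Type*) [Field 𝔽] (d : ℕ) : ℕ :=
  sInf {c | ∃ k, c = k + 1 ∧ ∀ a : ℕ → NilAlg 𝔽 d, consecProd a k = 0}

/-- A set of words is a basis of `N_{3,d}` over `𝔽` if the images of its elements (indexed by the
words) are linearly independent and span `N_{3,d}`. -/
def IsWordBasis (𝔽 : Type*) [Field 𝔽] {d : ℕ} (B : Set (FreeSemigroup (Fin d))) : Prop :=
  LinearIndependent 𝔽 (fun w : B => NilAlg.word 𝔽 (w : FreeSemigroup (Fin d))) ∧
    Submodule.span 𝔽 (NilAlg.word 𝔽 '' B) = ⊤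

/-- The set of words `x_i x_j x_i` with `i < j`. -/
def sandwichWords (d : ℕ) : Set (FreeSemigroup (Fin d)) :=
  {w | ∃ i j : Fin d, i < j ∧
    w = FreeSemigroup.of i * FreeSemigroup.of j * FreeSemigroup.of i}

/-!
Write `t(x, y) = x²y + xyx + yx²` and `T(x, y, z)` for the two polarizations of the cube (`sqPol`
and `linPol`). Over an infinite field the ideal of cubes is spanned by the cubes of words, by `t` and
`T` at words, and by their products with words (`polIdeal_eq_cubeIdeal`). These generators have
coefficients in the prime field, so this ideal, `polIdeal`, makes sense over `𝔽₂`, and membership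
passes between `L` and `𝔽₂` by applying additive maps to the coefficients (`coeffMap_mem_polIdeal`).

Over `𝔽₂` the identity `x³ = 0` gives `T = 0`, but only `t(x, y) = t(y, x)` in place of `t = 0`. It
follows that `t(x, yz) = t(x, y)z`, that `z t(x, y) = t(x, z)y`, and finally, by expanding
`t(xy, z)`, that `t(xy, z) = 0` (`sqPol_mul_left_eq_zero`). So `t` vanishes once an argument is a
product, and all products with values of `t` vanish. Hence `polIdeal` exceeds the ideal of cubes over
`𝔽₂` only by the elements `t(x_i, x_j)`, `i < j` (`polIdeal_le_cubeIdeal_sup`). These are independent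
modulo the ideal of cubes: the sum of the coefficients at `x_i x_j x_i` and `x_j x_i x_j` vanishes
on that ideal, as `a²b + ab² = 0` in `𝔽₂`, and separates them (`coeff_sandwich_add_swap`). The
comparison of bases (`isWordBasis_union_sandwichWords`) and the formula for the dimensions follow:
a basis over `L` that avoids `x_i x_j x_i` has to contain `x_i² x_j` and `x_j x_i²`, and the sandwich
words make up for the lost relations `t(x_i, x_j)`.

For the nilpotency degree over `L`, the identity `t = 0` lets us collect two occurrences of a letter
into a square, `x a x = x²a + a x²`, and it implies `x² a y² = 0` (`sq_mul_mul_sq`). With this, a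
product vanishes if some factor occurs four times, if three factors occur twice each, or if it has
at least six factors, one of which occurs three times and another one twice. By the pigeonhole
principle this covers all words with at least `d + 3` and at least `6` letters
(`NilAlg.word_eq_zero`), and such words are zero over `𝔽₂` as well because the two ideals differ only
in degree three. In the other direction, `x₁ x₁ x₂ x₁ x₃ ⋯ x_d` (and `x₁ x₁ x₂ x₁ x₂` for `d = 2`) is
nonzero in characteristic two: the linear form that counts the factors `x₁ x₁` in the rearrangements
of this word vanishes on `polIdeal` (`CubeRel.sum_pairWeight`).
-/

/-! ### Polarizations of the cube -/

/-- The part of `(x + y) ^ 3` that is quadratic in `x` and linear in `y`. -/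
def sqPol {A : Type*} [Mul A] [Add A] (x y : A) : A := x * x * y + x * y * x + y * x * x

/-- The full polarization of the cube, i.e. the part of `(x + y + z) ^ 3` that is linear in each
variable. -/
def linPol {A : Type*} [Mul A] [Add A] (x y z : A) : A :=
  x * y * z + x * z * y + y * x * z + y * z * x + z * x * y + z * y * x

section Polarization

variable {A : Type*} [NonUnitalRing A]

theorem sqPol_add_right (x y z : A) : sqPol x (y + z) = sqPol x y + sqPol x z := by
  simp only [sqPol, mul_add, add_mul]
  abel

theorem sqPol_add_left (x y z : A) :
    sqPol (x + y) z = sqPol x z + sqPol y z + linPol x y z := by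
  simp only [sqPol, linPol, mul_add, add_mul, mul_assoc]
  abel

theorem cube_add (x y : A) :
    (x + y) * (x + y) * (x + y) = x * x * x + (sqPol x y + sqPol y x) + y * y * y := by
  simp only [sqPol, mul_add, add_mul, mul_assoc]
  abel

theorem sqPol_add_swap_eq_zero (hA : ∀ x : A, x * x * x = 0) (x y : A) :
    sqPol x y + sqPol y x = 0 := by
  have h := cube_add x y
  rw [hA, hA, hA] at h
  simpa using h.symm

theorem linPol_eq_zero (hA : ∀ x : A, x * x * x = 0) (x y z : A) : linPol x y z = 0 := by
  have h := sqPol_add_swap_eq_zero hA (x + y) z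
  have h₁ := sqPol_add_swap_eq_zero hA x z
  have h₂ := sqPol_add_swap_eq_zero hA y z
  rw [sqPol_add_left, sqPol_add_right] at h
  have h₃ : linPol x y z = (sqPol x z + sqPol y z + linPol x y z + (sqPol z x + sqPol z y)) -
      (sqPol x z + sqPol z x) - (sqPol y z + sqPol z y) := by abel
  rw [h₃, h, h₁, h₂, sub_zero, sub_zero]

/-- A scalar `c ≠ 0, 1` separates the two mixed parts of `(x + y) ^ 3`, which have different
degrees in `y`. -/
theorem sqPol_eq_zero_of_scalar {K : Type*} [Field K] [Module K A] [IsScalarTower K A A]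
    [SMulCommClass K A A] (hA : ∀ x : A, x * x * x = 0) {c : K} (h0 : c ≠ 0) (h1 : c ≠ 1)
    (x y : A) : sqPol x y = 0 := by
  have h := sqPol_add_swap_eq_zero hA x y
  have hc := sqPol_add_swap_eq_zero hA x (c • y)
  have e₁ : sqPol x (c • y) = c • sqPol x y := by
    simp only [sqPol, mul_smul_comm, smul_mul_assoc, smul_add]
  have e₂ : sqPol (c • y) x = (c * c) • sqPol y x := by
    simp only [sqPol, mul_smul_comm, smul_mul_assoc, smul_add, smul_smul]
  rw [e₁, e₂, eq_neg_of_add_eq_zero_right h, smul_neg, ← sub_eq_add_neg, ← sub_smul] at hc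
  refine (smul_eq_zero.1 hc).resolve_left ?_
  have : c - c * c = c * (1 - c) := by ring
  rw [this]
  exact mul_ne_zero h0 (sub_ne_zero.2 h1.symm)

end Polarization

/-! ### Consequences of `x ^ 3 = 0` in characteristic two -/

theorem sqPol_mul_right_identity {A : Type*} [NonUnitalRing A] [Module (ZMod 2) A] (x y z : A) :
    sqPol x (y * z) = sqPol x y * z + (linPol x (x * y) z + linPol x (x * z) y +
      linPol x (y * x) z + linPol (x * x) y z) := by
  simp only [sqPol, linPol, add_mul, mul_assoc]
  rw [← sub_eq_zero, ← one_smul (ZMod 2) (_ - _)]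
  match_scalars <;> decide

theorem mul_sqPol_identity {A : Type*} [NonUnitalRing A] [Module (ZMod 2) A] (x y z : A) :
    z * sqPol x y = sqPol x z * y + (linPol x (x * z) y + linPol x (y * x) z) := by
  simp only [sqPol, linPol, mul_add, add_mul, mul_assoc]
  rw [← sub_eq_zero, ← one_smul (ZMod 2) (_ - _)]
  match_scalars <;> decide

/-- The expansion of `sqPol (x * y) z` by which `sqPol_mul_left_eq_zero` is proved: it rewrites
`x y x y` as `y² x²` and pulls the squares out of `x y z x y`; the six products of `x²`, `y²`, `z` that
remain form a value of `linPol`. -/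
theorem sqPol_mul_left_identity {A : Type*} [NonUnitalRing A] [Module (ZMod 2) A] (x y z : A) :
    sqPol (x * y) z = sqPol x y * y * z + sqPol y (x * x) * z + z * (sqPol x y * y) +
      z * sqPol y (x * x) + sqPol x (y * z) * y + x * (x * sqPol y z) + sqPol y (z * (x * x)) +
      linPol (x * x) (y * y) z := by
  simp only [sqPol, linPol, mul_add, add_mul, mul_assoc]
  rw [← sub_eq_zero, ← one_smul (ZMod 2) (_ - _)]
  match_scalars <;> decide

section CharTwo

variable {A : Type*} [NonUnitalRing A] [Module (ZMod 2) A]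

theorem add_self_eq_zero_of_module (a : A) : a + a = 0 := by
  rw [← two_smul (ZMod 2) a, show (2 : ZMod 2) = 0 from rfl, zero_smul]

theorem sqPol_comm (hA : ∀ x : A, x * x * x = 0) (x y : A) : sqPol x y = sqPol y x := by
  rw [eq_neg_of_add_eq_zero_left (sqPol_add_swap_eq_zero hA x y),
    neg_eq_of_add_eq_zero_left (add_self_eq_zero_of_module _)]

theorem sqPol_mul_right (hA : ∀ x : A, x * x * x = 0) (x y z : A) :
    sqPol x (y * z) = sqPol x y * z := by
  simp [sqPol_mul_right_identity, linPol_eq_zero hA]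

theorem mul_sqPol (hA : ∀ x : A, x * x * x = 0) (x y z : A) :
    z * sqPol x y = sqPol x z * y := by
  simp [mul_sqPol_identity, linPol_eq_zero hA]

theorem mul_sqPol_self_left (hA : ∀ x : A, x * x * x = 0) (x y : A) : x * sqPol x y = 0 := by
  rw [mul_sqPol hA]
  simp [sqPol, hA]

theorem mul_sqPol_self_right (hA : ∀ x : A, x * x * x = 0) (x y : A) : y * sqPol x y = 0 := by
  rw [sqPol_comm hA, mul_sqPol_self_left hA]

theorem sqPol_mul_self_right (hA : ∀ x : A, x * x * x = 0) (x y : A) : sqPol x y * y = 0 := by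
  rw [← mul_sqPol hA, mul_sqPol_self_right hA]

theorem sqPol_mul_self_left (hA : ∀ x : A, x * x * x = 0) (x y : A) : sqPol x y * x = 0 := by
  rw [sqPol_comm hA, sqPol_mul_self_right hA]

/-- The key to the comparison of the two fields: although `x ^ 3 = 0` over `𝔽₂` only forces
`sqPol` to be symmetric, `sqPol` vanishes as soon as one argument is a product. -/
theorem sqPol_mul_left_eq_zero (hA : ∀ x : A, x * x * x = 0) (x y z : A) :
    sqPol (x * y) z = 0 := by
  have e₁ : sqPol y (x * x) = 0 := by
    rw [sqPol_mul_right hA, sqPol_mul_self_right hA]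
  have e₂ : sqPol x (y * z) * y = 0 := by
    rw [sqPol_comm hA, ← sqPol_mul_right hA, sqPol_comm hA, sqPol_mul_right hA,
      sqPol_comm hA, sqPol_mul_right hA, sqPol_mul_self_left hA, zero_mul]
  have e₃ : x * sqPol y z = sqPol x y * z := by rw [mul_sqPol hA, sqPol_comm hA]
  have e₄ : sqPol y (z * (x * x)) = 0 := by
    rw [← mul_assoc, sqPol_mul_right hA, sqPol_mul_right hA, ← mul_sqPol hA, mul_assoc,
      sqPol_mul_self_right hA, mul_zero]
  rw [sqPol_mul_left_identity, linPol_eq_zero hA, e₁, e₂, e₃, e₄, sqPol_mul_self_right hA,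
    ← mul_assoc x, mul_sqPol_self_left hA]
  simp

theorem sqPol_mul_right_eq_zero (hA : ∀ x : A, x * x * x = 0) (x y z : A) :
    sqPol x (y * z) = 0 := by
  rw [sqPol_comm hA, sqPol_mul_left_eq_zero hA]

theorem sqPol_mul_eq_zero (hA : ∀ x : A, x * x * x = 0) (x y z : A) : sqPol x y * z = 0 := by
  rw [← sqPol_mul_right hA, sqPol_mul_right_eq_zero hA]

theorem mul_sqPol_eq_zero (hA : ∀ x : A, x * x * x = 0) (x y z : A) : z * sqPol x y = 0 := by
  rw [mul_sqPol hA, sqPol_mul_eq_zero hA]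

end CharTwo

/-! ### Vanishing products when the polarizations vanish -/

section Vanishing

variable {A : Type*} [NonUnitalRing A] [Module (ZMod 2) A]

/-- Two occurrences of `x` can be collected into a square. -/
theorem sandwich_eq (hs : ∀ x y : A, sqPol x y = 0) (x a : A) :
    x * a * x = x * x * a + a * (x * x) := by
  have h : x * a * x = x * x * a + a * (x * x) + sqPol x a := by
    simp only [sqPol, mul_assoc]
    rw [← sub_eq_zero, ← one_smul (ZMod 2) (_ - _)]
    match_scalars <;> decide
  rw [h, hs, add_zero]

/-- Two squares with a factor in between annihilate each other. The identity behind this expands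
`x² a y²` into values of `sqPol` alone. -/
theorem sq_mul_mul_sq (hs : ∀ x y : A, sqPol x y = 0) (x y a : A) :
    x * x * a * (y * y) = 0 := by
  have h : x * x * a * (y * y) = sqPol x a * (y * y) + sqPol x (a * y) * y +
      sqPol x (a * y * y) + a * sqPol y (x * x) + x * a * sqPol y x := by
    simp only [sqPol, mul_add, add_mul, mul_assoc]
    rw [← sub_eq_zero, ← one_smul (ZMod 2) (_ - _)]
    match_scalars <;> decide
  simp [h, hs]

theorem sq_mul_mul_self (hA : ∀ x : A, x * x * x = 0) (hs : ∀ x y : A, sqPol x y = 0) (x a : A) :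
    x * x * a * x = x * a * (x * x) := by
  have h : x * x * a * x = x * (x * a * x) := by simp only [mul_assoc]
  have h' : x * (x * x * a) = x * x * x * a := by simp only [mul_assoc]
  rw [h, sandwich_eq hs, mul_add, h', hA, zero_mul, zero_add, mul_assoc]

/-- Commutators of squares are central. -/
theorem sq_mul_sq_comm (hA : ∀ x : A, x * x * x = 0) (hs : ∀ x y : A, sqPol x y = 0)
    (x y z : A) : x * x * (y * y) * z + y * y * (x * x) * z + z * (x * x) * (y * y) +
      z * (y * y) * (x * x) = 0 := by
  have h := linPol_eq_zero hA (x * x) (y * y) z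
  simp only [linPol] at h
  rw [sq_mul_mul_sq hs, sq_mul_mul_sq hs, add_zero, add_zero] at h
  exact h

/-- The product `x² y² x` equals `[x², y²] x`, and the central commutator `[x², y²]` kills every
product `x a`; likewise on the other side in `mul_sq_mul_sq_mul_self`. -/
theorem sq_mul_sq_mul_self_mul (hA : ∀ x : A, x * x * x = 0) (hs : ∀ x y : A, sqPol x y = 0)
    (x y a : A) : x * x * (y * y) * x * a = 0 := by
  have h := sq_mul_sq_comm hA hs x y (x * a)
  have e₁ : y * y * (x * x) * (x * a) = y * y * (x * x * x) * a := by simp only [mul_assoc]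
  have e₂ : x * a * (x * x) * (y * y) = 0 := by
    rw [← sq_mul_mul_self hA hs, mul_assoc (x * x), sq_mul_mul_sq hs]
  have e₃ : x * a * (y * y) * (x * x) = 0 := by
    rw [mul_assoc x, ← sq_mul_mul_self hA hs, ← mul_assoc (x * x), sq_mul_mul_sq hs, zero_mul]
  rw [e₁, hA, mul_zero, zero_mul, e₂, e₃, add_zero, add_zero, add_zero, ← mul_assoc] at h
  exact h

theorem mul_sq_mul_sq_mul_self (hA : ∀ x : A, x * x * x = 0) (hs : ∀ x y : A, sqPol x y = 0)
    (x y a : A) : a * (x * x * (y * y) * x) = 0 := by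
  have h := sq_mul_sq_comm hA hs x y (a * x)
  have e₁ : a * x * (x * x) * (y * y) = a * (x * x * x) * (y * y) := by simp only [mul_assoc]
  have e₂ : x * x * (y * y) * (a * x) = 0 := by
    rw [← mul_assoc, mul_assoc (x * x), sq_mul_mul_self hA hs, mul_assoc x, sq_mul_mul_sq hs,
      mul_zero]
  have e₃ : y * y * (x * x) * (a * x) = 0 := by
    rw [mul_assoc (y * y), ← mul_assoc (x * x), sq_mul_mul_self hA hs, ← mul_assoc (y * y),
      sq_mul_mul_sq hs]
  rw [e₁, hA, mul_zero, zero_mul, e₂, e₃, zero_add, zero_add, zero_add] at h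
  rw [sq_mul_mul_self hA hs, ← h]
  simp only [mul_assoc]

end Vanishing

/-! ### Products of lists -/

section ListProducts

variable {A : Type*} [NonUnitalRing A] [Module (ZMod 2) A] [IsScalarTower (ZMod 2) A A]
  [SMulCommClass (ZMod 2) A A]

/-- The product of a possibly empty list of elements of `A`, formed in the unitization of `A`. -/
noncomputable def unitProd (l : List A) : Unitization (ZMod 2) A :=
  (l.map Unitization.inr).prod

theorem unitProd_append (l m : List A) : unitProd (l ++ m) = unitProd l * unitProd m := by
  simp [unitProd]

theorem unitProd_cons (a : A) (l : List A) : unitProd (a :: l) = a * unitProd l := by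
  simp [unitProd]

theorem exists_unitProd_eq {l : List A} (hl : l ≠ []) : ∃ a : A, unitProd l = a := by
  induction l with
  | nil => exact absurd rfl hl
  | cons a l ih =>
    rcases eq_or_ne l [] with rfl | h
    · exact ⟨a, by simp [unitProd]⟩
    · obtain ⟨b, hb⟩ := ih h
      exact ⟨a * b, by rw [unitProd_cons, hb, Unitization.inr_mul]⟩

/-- Every product of the elements of the multiset `s`, in whatever order, is zero. -/
def ProdsVanish (s : Multiset A) : Prop :=
  ∀ l : List A, (l : Multiset A) = s → unitProd l = 0

theorem exists_split_of_coe_eq_cons {α : Type*} {l : List α} {x : α} {s : Multiset α}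
    (h : (l : Multiset α) = x ::ₘ s) :
    ∃ p q, l = p ++ x :: q ∧ ((p ++ q : List α) : Multiset α) = s := by
  have hx : x ∈ l := by
    rw [← Multiset.mem_coe, h]
    exact Multiset.mem_cons_self x s
  obtain ⟨p, q, rfl⟩ := List.append_of_mem hx
  refine ⟨p, q, rfl, ?_⟩
  rw [← Multiset.cons_inj_right x, ← h, Multiset.cons_coe, Multiset.coe_eq_coe]
  exact List.perm_middle.symm

theorem exists_split_of_coe_eq_cons_cons {α : Type*} {l : List α} {x y : α} {s : Multiset α}
    (h : (l : Multiset α) = x ::ₘ y ::ₘ s) : ∃ p m q,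
      (l = p ++ x :: (m ++ y :: q) ∨ l = p ++ y :: (m ++ x :: q)) ∧
        ((p ++ (m ++ q) : List α) : Multiset α) = s := by
  obtain ⟨p, q, rfl, hpq⟩ := exists_split_of_coe_eq_cons h
  obtain ⟨p', q', hs, hpq'⟩ := exists_split_of_coe_eq_cons hpq
  rcases List.append_eq_append_iff.1 hs with ⟨a, h₁, h₂⟩ | ⟨a, h₁, h₂⟩
  · subst h₁ h₂
    exact ⟨p, a, q', Or.inl rfl, by simpa using hpq'⟩
  · cases a with
    | nil =>
      simp only [List.nil_append, List.append_nil] at h₁ h₂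
      subst h₁ h₂
      exact ⟨p, [], q', Or.inl rfl, by simpa using hpq'⟩
    | cons b a =>
      obtain ⟨rfl, rfl⟩ : y = b ∧ q' = a ++ q := by simpa using h₂
      subst h₁
      exact ⟨p', a, q, Or.inr (by simp), by simpa using hpq'⟩

/-- Products in which `x` occurs twice are sums of products with one factor `x²` instead, since
`x a x = x² a + a x²`. -/
theorem ProdsVanish.of_sq_cons (hs : ∀ x y : A, sqPol x y = 0) {x : A} {s : Multiset A}
    (h : ProdsVanish ((x * x) ::ₘ s)) : ProdsVanish (x ::ₘ x ::ₘ s) := by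
  intro l hl
  obtain ⟨p, m, q, hl', rfl⟩ := exists_split_of_coe_eq_cons_cons hl
  rw [or_self] at hl'
  subst hl'
  have h₁ := h (p ++ (x * x) :: (m ++ q))
    (by rw [Multiset.cons_coe, Multiset.coe_eq_coe]; exact List.perm_middle)
  have h₂ := h (p ++ (m ++ (x * x) :: q))
    (by rw [Multiset.cons_coe, Multiset.coe_eq_coe, ← List.append_assoc, ← List.append_assoc]
        exact List.perm_middle)
  simp only [unitProd_append, unitProd_cons] at h₁ h₂ ⊢
  rcases eq_or_ne m [] with rfl | hm
  · simpa [unitProd, mul_assoc] using h₁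
  · obtain ⟨a, ha⟩ := exists_unitProd_eq hm
    rw [ha] at h₁ h₂ ⊢
    have e : (x : Unitization (ZMod 2) A) * (a * x) = (x * x : A) * a + a * (x * x : A) := by
      rw [← Unitization.inr_mul, ← Unitization.inr_mul, ← Unitization.inr_mul,
        ← Unitization.inr_mul, ← Unitization.inr_add, ← mul_assoc, sandwich_eq hs]
    calc unitProd p * (x * (a * (x * unitProd q)))
        = unitProd p * (x * (a * x)) * unitProd q := by simp only [mul_assoc]
      _ = unitProd p * ((x * x : A) * (a * unitProd q)) +
          unitProd p * (a * ((x * x : A) * unitProd q)) := by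
        rw [e]; simp only [mul_add, add_mul, mul_assoc]
      _ = 0 := by rw [h₁, h₂, add_zero]

/-- Two squares separated by at least one factor annihilate the product. -/
theorem unitProd_sq_sq_eq_zero (hs : ∀ x y : A, sqPol x y = 0) (x y : A) (p : List A)
    {m : List A} (hm : m ≠ []) (q : List A) :
    unitProd (p ++ (x * x) :: (m ++ (y * y) :: q)) = 0 := by
  obtain ⟨a, ha⟩ := exists_unitProd_eq hm
  have e : ((x * x : A) : Unitization (ZMod 2) A) * (a * (y * y : A)) = 0 := by
    rw [← Unitization.inr_mul, ← Unitization.inr_mul, ← mul_assoc, sq_mul_mul_sq hs,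
      Unitization.inr_zero]
  simp only [unitProd_append, unitProd_cons, ha]
  calc unitProd p * ((x * x : A) * (a * ((y * y : A) * unitProd q)))
      = unitProd p * ((x * x : A) * (a * (y * y : A))) * unitProd q := by simp only [mul_assoc]
    _ = 0 := by rw [e, mul_zero, zero_mul]

theorem prodsVanish_sq_sq_sq (hs : ∀ x y : A, sqPol x y = 0) (x y z : A) (s : Multiset A) :
    ProdsVanish ((x * x) ::ₘ (y * y) ::ₘ (z * z) ::ₘ s) := by
  have key : ∀ (x y : A) (p m q : List A), z * z ∈ p ++ (m ++ q) →
      unitProd (p ++ (x * x) :: (m ++ (y * y) :: q)) = 0 := by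
    intro x y p m q hz
    rcases eq_or_ne m [] with rfl | hm
    · rcases List.mem_append.1 hz with hz | hz
      · obtain ⟨p, r, rfl⟩ := List.append_of_mem hz
        simpa using unitProd_sq_sq_eq_zero hs z y p (m := r ++ [x * x]) (by simp) q
      · obtain ⟨r, q, rfl⟩ := List.append_of_mem (by simpa using hz)
        simpa using unitProd_sq_sq_eq_zero hs x z p (m := (y * y) :: r) (by simp) q
    · exact unitProd_sq_sq_eq_zero hs x y p hm q
  intro l hl
  obtain ⟨p, m, q, hl, hpq⟩ := exists_split_of_coe_eq_cons_cons hl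
  have hz : z * z ∈ p ++ (m ++ q) := by
    rw [← Multiset.mem_coe, hpq]
    exact Multiset.mem_cons_self _ _
  rcases hl with rfl | rfl
  exacts [key x y p m q hz, key y x p m q hz]

theorem prodsVanish_sq_sq_self (hA : ∀ x : A, x * x * x = 0) (hs : ∀ x y : A, sqPol x y = 0)
    (x : A) (s : Multiset A) : ProdsVanish ((x * x) ::ₘ (x * x) ::ₘ s) := by
  intro l hl
  obtain ⟨p, m, q, hl, -⟩ := exists_split_of_coe_eq_cons_cons hl
  rw [or_self] at hl
  subst hl
  rcases eq_or_ne m [] with rfl | hm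
  · simp only [unitProd_append, unitProd_cons, List.nil_append]
    rw [← mul_assoc ((x * x : A) : Unitization (ZMod 2) A), ← Unitization.inr_mul, ← mul_assoc (x * x),
      hA]
    simp
  · exact unitProd_sq_sq_eq_zero hs x x p hm q

theorem prodsVanish_sq_self_sq (hA : ∀ x : A, x * x * x = 0) (hs : ∀ x y : A, sqPol x y = 0)
    (x y : A) {s : Multiset A} (h0 : s ≠ 0) :
    ProdsVanish ((x * x) ::ₘ x ::ₘ (y * y) ::ₘ s) := by
  intro l hl
  obtain ⟨p, m, q, hl, hpq⟩ := exists_split_of_coe_eq_cons_cons hl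
  have hy : y * y ∈ p ++ (m ++ q) := by
    rw [← Multiset.mem_coe, hpq]
    exact Multiset.mem_cons_self _ _
  -- The order of `x` and `x²` around `m` does not matter.
  have hswap : unitProd (p ++ x * x :: (m ++ x :: q)) =
      unitProd (p ++ x :: (m ++ x * x :: q)) := by
    simp only [unitProd_append, unitProd_cons]
    rcases eq_or_ne m [] with rfl | hm
    · simp [unitProd, mul_assoc]
    · obtain ⟨a, ha⟩ := exists_unitProd_eq hm
      rw [ha]
      calc unitProd p * ((x * x : A) * (a * (x * unitProd q)))
          = unitProd p * (x * x * a * x : A) * unitProd q := by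
            simp only [Unitization.inr_mul, mul_assoc]
        _ = unitProd p * (x * (a * ((x * x : A) * unitProd q))) := by
            rw [sq_mul_mul_self hA hs]
            simp only [Unitization.inr_mul, mul_assoc]
  suffices hmain : unitProd (p ++ x * x :: (m ++ x :: q)) = 0 by
    rcases hl with rfl | rfl
    · exact hmain
    · rw [← hswap, hmain]
  rcases List.mem_append.1 hy with hy | hy
  · obtain ⟨p, r, rfl⟩ := List.append_of_mem hy
    rw [hswap]
    simpa using unitProd_sq_sq_eq_zero hs y x p (m := r ++ x :: m) (by simp) q
  rcases List.mem_append.1 hy with hy | hy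
  · obtain ⟨m, r, rfl⟩ := List.append_of_mem hy
    rcases eq_or_ne m [] with rfl | hm
    · rcases eq_or_ne r [] with rfl | hr
      · -- Only `x² y² x` is left, and it is annihilated from both sides.
        rcases eq_or_ne q [] with rfl | hq
        · have hp : p ≠ [] := by
            rintro rfl
            exact h0 (Multiset.cons_inj_right (y * y) |>.1 (by rw [← hpq]; rfl))
          obtain ⟨a, ha⟩ := exists_unitProd_eq hp
          simp only [unitProd_append, unitProd_cons, List.nil_append, List.cons_append, ha]
          calc _ = ((a * (x * x * (y * y) * x) : A) : Unitization (ZMod 2) A) * unitProd [] := by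
                simp only [Unitization.inr_mul, mul_assoc]
            _ = 0 := by rw [mul_sq_mul_sq_mul_self hA hs, Unitization.inr_zero, zero_mul]
        · obtain ⟨a, ha⟩ := exists_unitProd_eq hq
          simp only [unitProd_append, unitProd_cons, List.nil_append, List.cons_append, ha]
          calc _ = unitProd p * ((x * x * (y * y) * x * a : A) : Unitization (ZMod 2) A) := by
                simp only [Unitization.inr_mul, mul_assoc]
            _ = 0 := by rw [sq_mul_sq_mul_self_mul hA hs, Unitization.inr_zero, mul_zero]
      · rw [hswap]
        simpa using unitProd_sq_sq_eq_zero hs y x (p ++ [x]) hr q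
    · simpa using unitProd_sq_sq_eq_zero hs x y p hm (r ++ x :: q)
  · obtain ⟨r, q, rfl⟩ := List.append_of_mem hy
    simpa using unitProd_sq_sq_eq_zero hs x y p (m := m ++ x :: r) (by simp) q

end ListProducts

/-! ### Long words vanish over an infinite field -/

section Words

variable {d : ℕ}

/-- The word `w` as a list of letters. -/
def FreeSemigroup.toList {α : Type*} (w : FreeSemigroup α) : List α := w.head :: w.tail

theorem FreeSemigroup.toList_mul {α : Type*} (v w : FreeSemigroup α) :
    (v * w).toList = v.toList ++ w.toList := rfl

theorem FreeSemigroup.toList_ne_nil {α : Type*} (w : FreeSemigroup α) : w.toList ≠ [] := by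
  simp [FreeSemigroup.toList]

theorem FreeSemigroup.length_toList {α : Type*} (w : FreeSemigroup α) :
    w.toList.length = w.length := by
  simp [FreeSemigroup.toList, FreeSemigroup.length]

theorem FreeSemigroup.toList_injective {α : Type*} :
    Function.Injective (FreeSemigroup.toList : FreeSemigroup α → List α) := by
  intro v w h
  simp only [FreeSemigroup.toList, List.cons.injEq] at h
  exact FreeSemigroup.ext h.1 h.2

theorem cube_mem_cubeIdeal {K : Type*} [Field K] (x : FreeAlg K d) :
    x * x * x ∈ cubeIdeal K d := by
  rw [cubeIdeal, Submodule.mem_sInf]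
  exact fun J hJ => hJ.1 x

theorem NilAlg.mk_eq_zero {K : Type*} [Field K] {f : FreeAlg K d} :
    NilAlg.mk K d f = 0 ↔ f ∈ cubeIdeal K d := by
  rw [← map_zero (NilAlg.mk K d), NilAlg.mk_eq_mk, sub_zero]

theorem NilAlg.cube_eq_zero {K : Type*} [Field K] (x : NilAlg K d) : x * x * x = 0 := by
  obtain ⟨f, rfl⟩ := NilAlg.mk_surjective K d x
  rw [← NilAlg.mk_mul, ← NilAlg.mk_mul, NilAlg.mk_eq_zero]
  exact cube_mem_cubeIdeal f

theorem NilAlg.word_mul {K : Type*} [Field K] (v w : FreeSemigroup (Fin d)) :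
    NilAlg.word K (v * w) = NilAlg.word K v * NilAlg.word K w := by
  rw [NilAlg.word, NilAlg.word, NilAlg.word, ← NilAlg.mk_mul, MonoidAlgebra.single_mul_single,
    one_mul]

theorem exists_ne_zero_ne_one (K : Type*) [Field K] [Infinite K] : ∃ c : K, c ≠ 0 ∧ c ≠ 1 := by
  classical
  obtain ⟨c, hc⟩ := Infinite.exists_notMem_finset ({0, 1} : Finset K)
  exact ⟨c, by simpa [not_or] using hc⟩

theorem NilAlg.sqPol_eq_zero {L : Type*} [Field L] [Infinite L] (x y : NilAlg L d) :
    sqPol x y = 0 := by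
  obtain ⟨c, h0, h1⟩ := exists_ne_zero_ne_one L
  exact sqPol_eq_zero_of_scalar NilAlg.cube_eq_zero h0 h1 x y

theorem add_self_eq_zero_of_charTwo (K : Type*) [Field K] [CharP K 2] {M : Type*}
    [AddCommGroup M] [Module K M] (x : M) : x + x = 0 := by
  rw [← two_smul K x, CharTwo.two_eq_zero, zero_smul]

/-- The pigeonhole behind the bound `d + 3`: a long multiset of `d` letters has a letter of
multiplicity at least four, or two letters of multiplicities at least three and two, or three
letters of multiplicity at least two. -/
theorem exists_repeated_letters (s : Multiset (Fin d)) (hs : d + 3 ≤ s.card) :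
    (∃ i t, s = i ::ₘ i ::ₘ i ::ₘ i ::ₘ t) ∨ (∃ i j t, s = i ::ₘ i ::ₘ i ::ₘ j ::ₘ j ::ₘ t) ∨
      ∃ i j k t, s = i ::ₘ i ::ₘ j ::ₘ j ::ₘ k ::ₘ k ::ₘ t := by
  have hsum : ∑ i, s.count i = s.card := by simp
  by_contra! hcon
  obtain ⟨h4, h32, h222⟩ := hcon
  have key : ∀ u : Multiset (Fin d), u ≤ s → ∃ t, s = u + t := fun u h => le_iff_exists_add.1 h
  have c4 : ∀ i, s.count i ≤ 3 := by
    intro i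
    by_contra! h
    obtain ⟨t, ht⟩ := key _ (Multiset.le_count_iff_replicate_le.1 h)
    exact h4 i t (by simpa [Multiset.replicate_succ] using ht)
  have c32 : ∀ i j, i ≠ j → 3 ≤ s.count i → s.count j ≤ 1 := by
    intro i j hij hi
    by_contra! hj
    obtain ⟨t, ht⟩ := key (i ::ₘ i ::ₘ i ::ₘ j ::ₘ j ::ₘ 0) (by
      rw [Multiset.le_iff_count]
      intro k
      simp only [Multiset.count_cons, Multiset.count_zero]
      split_ifs <;> subst_vars <;> omega)
    exact h32 i j t (by simpa using ht)
  have c222 : ∀ i j k, i ≠ j → i ≠ k → j ≠ k → 2 ≤ s.count i → 2 ≤ s.count j →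
      s.count k ≤ 1 := by
    intro i j k hij hik hjk hi hj
    by_contra! hk
    obtain ⟨t, ht⟩ := key (i ::ₘ i ::ₘ j ::ₘ j ::ₘ k ::ₘ k ::ₘ 0) (by
      rw [Multiset.le_iff_count]
      intro l
      simp only [Multiset.count_cons, Multiset.count_zero]
      split_ifs <;> subst_vars <;> omega)
    exact h222 i j k t (by simpa using ht)
  by_cases h3 : ∃ i, 3 ≤ s.count i
  · obtain ⟨i, hi⟩ := h3
    have : ∑ j, s.count j ≤ ∑ j, (1 + if j = i then 2 else 0) := by
      refine Finset.sum_le_sum fun j _ => ?_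
      split_ifs with h
      · exact c4 j
      · exact c32 i j (Ne.symm h) hi
    rw [Finset.sum_add_distrib] at this
    simp at this
    omega
  · push Not at h3
    have hcard : (Finset.univ.filter fun i => 2 ≤ s.count i).card ≤ 2 := by
      by_contra! h
      obtain ⟨i, hi, j, hj, k, hk, hij, hik, hjk⟩ := Finset.two_lt_card.1 h
      simp only [Finset.mem_filter, Finset.mem_univ, true_and] at hi hj hk
      have := c222 i j k hij hik hjk hi hj
      omega
    have : ∑ j, s.count j ≤ ∑ j, (1 + if 2 ≤ s.count j then 1 else 0) := by
      refine Finset.sum_le_sum fun j _ => ?_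
      have := h3 j
      split_ifs <;> omega
    rw [Finset.sum_add_distrib, ← Finset.card_filter] at this
    simp at this
    omega

theorem prodsVanish_map {A : Type*} [NonUnitalRing A] [Module (ZMod 2) A]
    [IsScalarTower (ZMod 2) A A] [SMulCommClass (ZMod 2) A A] (hA : ∀ x : A, x * x * x = 0)
    (hs : ∀ x y : A, sqPol x y = 0) (g : Fin d → A) (s : Multiset (Fin d))
    (h6 : 6 ≤ s.card) (hd : d + 3 ≤ s.card) : ProdsVanish (s.map g) := by
  rcases exists_repeated_letters s hd with ⟨i, t, rfl⟩ | ⟨i, j, t, rfl⟩ | ⟨i, j, k, t, rfl⟩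
  · simp only [Multiset.map_cons]
    refine ProdsVanish.of_sq_cons hs ?_
    rw [Multiset.cons_swap, Multiset.cons_swap (g i * g i)]
    exact ProdsVanish.of_sq_cons hs (prodsVanish_sq_sq_self hA hs _ _)
  · have ht : t.map g ≠ 0 := by
      intro h
      have := congrArg Multiset.card h
      simp at this
      simp [this] at h6
    simp only [Multiset.map_cons]
    refine ProdsVanish.of_sq_cons hs ?_
    rw [Multiset.cons_swap (g i) (g j), Multiset.cons_swap (g i) (g j),
      Multiset.cons_swap (g i * g i), Multiset.cons_swap (g i * g i)]
    refine ProdsVanish.of_sq_cons hs ?_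
    rw [Multiset.cons_swap (g j * g j), Multiset.cons_swap (g j * g j)]
    exact prodsVanish_sq_self_sq hA hs _ _ ht
  · simp only [Multiset.map_cons]
    refine ProdsVanish.of_sq_cons hs ?_
    rw [Multiset.cons_swap (g i * g i), Multiset.cons_swap (g i * g i)]
    refine ProdsVanish.of_sq_cons hs ?_
    rw [Multiset.cons_swap (g i * g i), Multiset.cons_swap (g j * g j),
      Multiset.cons_swap (g i * g i), Multiset.cons_swap (g j * g j)]
    refine ProdsVanish.of_sq_cons hs ?_
    exact prodsVanish_sq_sq_sq hs _ _ _ _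

theorem NilAlg.word_eq_zero {L : Type*} [Field L] [Infinite L] [CharP L 2]
    {w : FreeSemigroup (Fin d)} (h6 : 6 ≤ w.length) (hd : d + 3 ≤ w.length) :
    NilAlg.word L w = 0 := by
  let _ : Module (ZMod 2) (NilAlg L d) :=
    AddCommGroup.zmodModule (by intro x; rw [two_nsmul, add_self_eq_zero_of_charTwo L])
  have : IsScalarTower (ZMod 2) (NilAlg L d) (NilAlg L d) :=
    ⟨fun c x y => ZMod.map_smul (AddMonoidHom.mulRight y) c x⟩
  have : SMulCommClass (ZMod 2) (NilAlg L d) (NilAlg L d) :=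
    ⟨fun c x y => (ZMod.map_smul (AddMonoidHom.mulLeft x) c y).symm⟩
  have hword : (NilAlg.word L w : Unitization (ZMod 2) (NilAlg L d)) =
      unitProd (w.toList.map fun i => NilAlg.word L (FreeSemigroup.of i)) := by
    clear h6 hd
    induction w using FreeSemigroup.recOnMul with
    | ih1 i => simp [FreeSemigroup.toList, FreeSemigroup.of, unitProd]
    | ih2 i w hi hw =>
      rw [NilAlg.word_mul, Unitization.inr_mul, hi, hw, FreeSemigroup.toList_mul, List.map_append,
        unitProd_append]
  refine Unitization.inr_injective (R := ZMod 2) ?_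
  rw [hword, Unitization.inr_zero]
  refine prodsVanish_map NilAlg.cube_eq_zero NilAlg.sqPol_eq_zero _ (w.toList : Multiset (Fin d))
    ?_ ?_ _ rfl
  all_goals simpa [FreeSemigroup.length_toList]

end Words

/-! ### The multihomogeneous ideal -/

section PolIdeal

variable {d : ℕ}

/-- The sum in `𝕂⟨X⟩_d` of the words in `r`. -/
noncomputable def wordSum (K : Type*) [Field K] (r : Multiset (FreeSemigroup (Fin d))) :
    FreeAlg K d :=
  (r.map fun w => MonoidAlgebra.single w 1).sum

/-- Sums of words, recorded as multisets of words, that are obtained from `u ^ 3` and its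
polarizations at words by multiplication with words. They do not mention the field. -/
inductive CubeRel : Multiset (FreeSemigroup (Fin d)) → Prop
  | cube (u) : CubeRel {u * u * u}
  | sq (u v) : CubeRel {u * u * v, u * v * u, v * u * u}
  | lin (u v w) : CubeRel {u * v * w, u * w * v, v * u * w, v * w * u, w * u * v, w * v * u}
  | mul_left (a r) : CubeRel r → CubeRel (r.map (a * ·))
  | mul_right (a r) : CubeRel r → CubeRel (r.map (· * a))

/-- The ideal spanned by the cubes of words, their polarizations, and the products of these with
words. Its generators have coefficients `1`, so that it is the same ideal over all fields up to
extension of scalars. -/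
noncomputable def polIdeal (K : Type*) [Field K] (d : ℕ) : Submodule K (FreeAlg K d) :=
  Submodule.span K (wordSum K '' {r | CubeRel r})

variable {K : Type*} [Field K]

theorem wordSum_mem_polIdeal {r : Multiset (FreeSemigroup (Fin d))} (h : CubeRel r) :
    wordSum K r ∈ polIdeal K d :=
  Submodule.subset_span ⟨r, h, rfl⟩

theorem wordSum_cube (u : FreeSemigroup (Fin d)) : wordSum K {u * u * u} =
    MonoidAlgebra.single u 1 * MonoidAlgebra.single u 1 * MonoidAlgebra.single u 1 := by
  simp [wordSum, MonoidAlgebra.single_mul_single]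

theorem wordSum_sq (u v : FreeSemigroup (Fin d)) :
    wordSum K {u * u * v, u * v * u, v * u * u} =
      sqPol (MonoidAlgebra.single u 1) (MonoidAlgebra.single v 1) := by
  simp [wordSum, sqPol, MonoidAlgebra.single_mul_single, add_assoc]

theorem wordSum_lin (u v w : FreeSemigroup (Fin d)) :
    wordSum K {u * v * w, u * w * v, v * u * w, v * w * u, w * u * v, w * v * u} =
      linPol (MonoidAlgebra.single u 1) (MonoidAlgebra.single v 1)
        (MonoidAlgebra.single w 1) := by
  simp [wordSum, linPol, MonoidAlgebra.single_mul_single, add_assoc]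

theorem wordSum_map_mul_left (a : FreeSemigroup (Fin d)) (r : Multiset (FreeSemigroup (Fin d))) :
    wordSum K (r.map (a * ·)) = MonoidAlgebra.single a 1 * wordSum K r := by
  rw [wordSum, wordSum, Multiset.map_map, ← Multiset.sum_map_mul_left]
  simp [MonoidAlgebra.single_mul_single]

theorem wordSum_map_mul_right (a : FreeSemigroup (Fin d)) (r : Multiset (FreeSemigroup (Fin d))) :
    wordSum K (r.map (· * a)) = wordSum K r * MonoidAlgebra.single a 1 := by
  rw [wordSum, wordSum, Multiset.map_map, ← Multiset.sum_map_mul_right]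
  simp [MonoidAlgebra.single_mul_single]

theorem single_eq_smul (w : FreeSemigroup (Fin d)) (c : K) :
    (MonoidAlgebra.single w c : FreeAlg K d) = c • MonoidAlgebra.single w 1 := by
  rw [MonoidAlgebra.smul_single, smul_eq_mul, mul_one]

theorem freeAlg_induction {P : FreeAlg K d → Prop} (f : FreeAlg K d) (h0 : P 0)
    (hadd : ∀ f g, P f → P g → P (f + g))
    (hs : ∀ w (c : K), P (c • MonoidAlgebra.single w 1)) : P f :=
  MonoidAlgebra.induction_linear f h0 hadd fun w c => by rw [single_eq_smul]; exact hs w c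

theorem mul_mem_polIdeal (a : FreeAlg K d) {f : FreeAlg K d} (hf : f ∈ polIdeal K d) :
    a * f ∈ polIdeal K d ∧ f * a ∈ polIdeal K d := by
  induction a using freeAlg_induction with
  | h0 => simp
  | hadd a b ha hb =>
    rw [add_mul, mul_add]
    exact ⟨add_mem ha.1 hb.1, add_mem ha.2 hb.2⟩
  | hs w c =>
    rw [smul_mul_assoc, mul_smul_comm]
    suffices h : MonoidAlgebra.single w 1 * f ∈ polIdeal K d ∧
        f * MonoidAlgebra.single w 1 ∈ polIdeal K d from
      ⟨Submodule.smul_mem _ _ h.1, Submodule.smul_mem _ _ h.2⟩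
    induction hf using Submodule.span_induction with
    | mem f hf =>
      obtain ⟨r, hr, rfl⟩ := hf
      rw [← wordSum_map_mul_left, ← wordSum_map_mul_right]
      exact ⟨wordSum_mem_polIdeal (hr.mul_left w), wordSum_mem_polIdeal (hr.mul_right w)⟩
    | zero => simp
    | add f g _ _ hf hg =>
      rw [mul_add, add_mul]
      exact ⟨add_mem hf.1 hg.1, add_mem hf.2 hg.2⟩
    | smul c f _ hf =>
      rw [mul_smul_comm, smul_mul_assoc]
      exact ⟨Submodule.smul_mem _ _ hf.1, Submodule.smul_mem _ _ hf.2⟩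

theorem linPol_mem_polIdeal (x y z : FreeAlg K d) : linPol x y z ∈ polIdeal K d := by
  induction x using freeAlg_induction with
  | h0 => simp [linPol]
  | hadd x x' hx hx' =>
    convert add_mem hx hx' using 1
    simp only [linPol, mul_add, add_mul]
    abel
  | hs u a =>
  induction y using freeAlg_induction with
  | h0 => simp [linPol]
  | hadd y y' hy hy' =>
    convert add_mem hy hy' using 1
    simp only [linPol, mul_add, add_mul]
    abel
  | hs v b =>
  induction z using freeAlg_induction with
  | h0 => simp [linPol]
  | hadd z z' hz hz' =>
    convert add_mem hz hz' using 1
    simp only [linPol, mul_add, add_mul]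
    abel
  | hs w c =>
  convert Submodule.smul_mem _ (a * b * c) (wordSum_mem_polIdeal (K := K) (CubeRel.lin u v w))
    using 1
  rw [wordSum_lin]
  simp only [linPol, smul_mul_smul_comm, smul_add]
  module

theorem sqPol_mem_polIdeal (x y : FreeAlg K d) : sqPol x y ∈ polIdeal K d := by
  induction x using freeAlg_induction with
  | h0 => simp [sqPol]
  | hadd x x' hx hx' =>
    rw [sqPol_add_left]
    exact add_mem (add_mem hx hx') (linPol_mem_polIdeal _ _ _)
  | hs u a =>
  induction y using freeAlg_induction with
  | h0 => simp [sqPol]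
  | hadd y y' hy hy' =>
    rw [sqPol_add_right]
    exact add_mem hy hy'
  | hs v b =>
  convert Submodule.smul_mem _ (a * a * b) (wordSum_mem_polIdeal (K := K) (CubeRel.sq u v))
    using 1
  rw [wordSum_sq]
  simp only [sqPol, smul_mul_smul_comm, smul_add]
  module

theorem cubeIdeal_le_polIdeal (K : Type*) [Field K] (d : ℕ) : cubeIdeal K d ≤ polIdeal K d := by
  refine sInf_le ⟨fun x => ?_, fun a f hf => mul_mem_polIdeal a hf⟩
  induction x using freeAlg_induction with
  | h0 => simp
  | hadd x y hx hy =>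
    rw [cube_add]
    exact add_mem (add_mem hx (add_mem (sqPol_mem_polIdeal _ _) (sqPol_mem_polIdeal _ _))) hy
  | hs w c =>
    rw [smul_mul_smul_comm, smul_mul_smul_comm, ← wordSum_cube]
    exact Submodule.smul_mem _ _ (wordSum_mem_polIdeal (CubeRel.cube w))

/-! ### The ideals over an infinite field and over the field with two elements -/

theorem NilAlg.mk_sqPol (f g : FreeAlg K d) :
    NilAlg.mk K d (sqPol f g) = sqPol (NilAlg.mk K d f) (NilAlg.mk K d g) := by
  simp only [sqPol, map_add, NilAlg.mk_mul]

theorem NilAlg.mk_linPol (f g h : FreeAlg K d) : NilAlg.mk K d (linPol f g h) =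
    linPol (NilAlg.mk K d f) (NilAlg.mk K d g) (NilAlg.mk K d h) := by
  simp only [linPol, map_add, NilAlg.mk_mul]

theorem polIdeal_eq_cubeIdeal (L : Type*) [Field L] [Infinite L] (d : ℕ) :
    polIdeal L d = cubeIdeal L d := by
  refine le_antisymm (Submodule.span_le.2 ?_) (cubeIdeal_le_polIdeal L d)
  rintro _ ⟨r, hr, rfl⟩
  rw [SetLike.mem_coe]
  induction hr with
  | cube u =>
    rw [wordSum_cube]
    exact cube_mem_cubeIdeal _
  | sq u v => rw [wordSum_sq, ← NilAlg.mk_eq_zero, NilAlg.mk_sqPol, NilAlg.sqPol_eq_zero]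
  | lin u v w =>
    rw [wordSum_lin, ← NilAlg.mk_eq_zero, NilAlg.mk_linPol, linPol_eq_zero NilAlg.cube_eq_zero]
  | mul_left a r _ ih =>
    rw [wordSum_map_mul_left]
    exact cubeIdeal_mul_left _ ih
  | mul_right a r _ ih =>
    rw [wordSum_map_mul_right]
    exact cubeIdeal_mul_right _ ih

/-- The letter `x_i` as an element of `𝕂⟨X⟩_d`. -/
noncomputable def letterPoly (K : Type*) [Field K] {d : ℕ} (i : Fin d) : FreeAlg K d :=
  MonoidAlgebra.single (FreeSemigroup.of i) 1

theorem FreeSemigroup.eq_of_or_eq_mul {α : Type*} (w : FreeSemigroup α) :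
    (∃ i, w = FreeSemigroup.of i) ∨ ∃ u v, w = u * v := by
  induction w using FreeSemigroup.recOnMul with
  | ih1 i => exact Or.inl ⟨i, rfl⟩
  | ih2 i w _ _ => exact Or.inr ⟨_, _, rfl⟩

/-- Over `𝔽₂`, only the polarizations `x_i² x_j + x_i x_j x_i + x_j x_i²` in the letters
themselves can fail to be in the ideal of cubes. -/
theorem CubeRel.mem_cubeIdeal_or_eq {r : Multiset (FreeSemigroup (Fin d))} (hr : CubeRel r) :
    wordSum (ZMod 2) r ∈ cubeIdeal (ZMod 2) d ∨
      ∃ i j, wordSum (ZMod 2) r = sqPol (letterPoly (ZMod 2) i) (letterPoly (ZMod 2) j) := by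
  induction hr with
  | cube u =>
    left
    rw [wordSum_cube]
    exact cube_mem_cubeIdeal _
  | sq u v =>
    rw [wordSum_sq]
    have hmul : ∀ u v : FreeSemigroup (Fin d),
        (MonoidAlgebra.single (u * v) 1 : FreeAlg (ZMod 2) d) =
          MonoidAlgebra.single u 1 * MonoidAlgebra.single v 1 := by
      simp [MonoidAlgebra.single_mul_single]
    rcases u.eq_of_or_eq_mul with ⟨i, rfl⟩ | ⟨u, u', rfl⟩
    · rcases v.eq_of_or_eq_mul with ⟨j, rfl⟩ | ⟨v, v', rfl⟩
      · exact Or.inr ⟨i, j, rfl⟩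
      · left
        rw [hmul, ← NilAlg.mk_eq_zero, NilAlg.mk_sqPol, NilAlg.mk_mul,
          sqPol_mul_right_eq_zero NilAlg.cube_eq_zero]
    · left
      rw [hmul, ← NilAlg.mk_eq_zero, NilAlg.mk_sqPol, NilAlg.mk_mul,
        sqPol_mul_left_eq_zero NilAlg.cube_eq_zero]
  | lin u v w =>
    left
    rw [wordSum_lin, ← NilAlg.mk_eq_zero, NilAlg.mk_linPol, linPol_eq_zero NilAlg.cube_eq_zero]
  | mul_left a r _ ih =>
    left
    rw [wordSum_map_mul_left]
    rcases ih with ih | ⟨i, j, ih⟩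
    · exact cubeIdeal_mul_left _ ih
    · rw [ih, ← NilAlg.mk_eq_zero, NilAlg.mk_mul, NilAlg.mk_sqPol,
        mul_sqPol_eq_zero NilAlg.cube_eq_zero]
  | mul_right a r _ ih =>
    left
    rw [wordSum_map_mul_right]
    rcases ih with ih | ⟨i, j, ih⟩
    · exact cubeIdeal_mul_right _ ih
    · rw [ih, ← NilAlg.mk_eq_zero, NilAlg.mk_mul, NilAlg.mk_sqPol,
        sqPol_mul_eq_zero NilAlg.cube_eq_zero]

theorem polIdeal_le_cubeIdeal_sup (d : ℕ) : polIdeal (ZMod 2) d ≤ cubeIdeal (ZMod 2) d ⊔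
    Submodule.span (ZMod 2) (Set.range fun p : {p : Fin d × Fin d // p.1 < p.2} =>
      sqPol (letterPoly (ZMod 2) p.1.1) (letterPoly (ZMod 2) p.1.2)) := by
  refine Submodule.span_le.2 ?_
  rintro _ ⟨r, hr, rfl⟩
  rw [SetLike.mem_coe]
  rcases hr.mem_cubeIdeal_or_eq with h | ⟨i, j, h⟩
  · exact Submodule.mem_sup_left h
  rw [h]
  rcases lt_trichotomy i j with hij | rfl | hij
  · exact Submodule.mem_sup_right (Submodule.subset_span ⟨⟨(i, j), hij⟩, rfl⟩)
  · refine Submodule.mem_sup_left ?_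
    rw [sqPol]
    exact add_mem (add_mem (cube_mem_cubeIdeal _) (cube_mem_cubeIdeal _)) (cube_mem_cubeIdeal _)
  · have hmem : sqPol (letterPoly (ZMod 2) i) (letterPoly (ZMod 2) j) -
        sqPol (letterPoly (ZMod 2) j) (letterPoly (ZMod 2) i) ∈ cubeIdeal (ZMod 2) d := by
      rw [← NilAlg.mk_eq_mk, NilAlg.mk_sqPol, NilAlg.mk_sqPol, sqPol_comm NilAlg.cube_eq_zero]
    rw [← sub_add_cancel (sqPol (letterPoly (ZMod 2) i) (letterPoly (ZMod 2) j))
      (sqPol (letterPoly (ZMod 2) j) (letterPoly (ZMod 2) i))]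
    exact add_mem (Submodule.mem_sup_left hmem)
      (Submodule.mem_sup_right (Submodule.subset_span ⟨⟨(j, i), hij⟩, rfl⟩))

/-! ### Change of coefficients -/

/-- The map on `𝕂⟨X⟩_d` that applies an additive map to all coefficients. -/
noncomputable def coeffMap {K L : Type*} [Field K] [Field L] (φ : K →+ L) :
    FreeAlg K d →+ FreeAlg L d where
  toFun f := MonoidAlgebra.ofCoeff (Finsupp.mapRange.addMonoidHom φ f.coeff)
  map_zero' := by simp
  map_add' f g :=
    congrArg MonoidAlgebra.ofCoeff (map_add (Finsupp.mapRange.addMonoidHom φ) f.coeff g.coeff)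

theorem coeff_coeffMap {K L : Type*} [Field K] [Field L] (φ : K →+ L) (f : FreeAlg K d)
    (w : FreeSemigroup (Fin d)) : (coeffMap φ f).coeff w = φ (f.coeff w) := by
  simp [coeffMap]

theorem coeffMap_single {K L : Type*} [Field K] [Field L] (φ : K →+ L)
    (w : FreeSemigroup (Fin d)) (c : K) :
    coeffMap φ (MonoidAlgebra.single w c) = MonoidAlgebra.single w (φ c) := by
  ext v
  simp [coeff_coeffMap, Finsupp.single_apply, apply_ite φ]

theorem coeffMap_smul_wordSum {K L : Type*} [Field K] [Field L] (φ : K →+ L) (c : K)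
    (r : Multiset (FreeSemigroup (Fin d))) :
    coeffMap φ (c • wordSum K r) = φ c • wordSum L r := by
  rw [wordSum, wordSum, Multiset.smul_sum, Multiset.smul_sum, map_multiset_sum, Multiset.map_map,
    Multiset.map_map, Multiset.map_map]
  simp [coeffMap_single]

theorem coeffMap_mem_polIdeal {K L : Type*} [Field K] [Field L] (φ : K →+ L) {f : FreeAlg K d}
    (hf : f ∈ polIdeal K d) : coeffMap φ f ∈ polIdeal L d := by
  obtain ⟨n, c, g, rfl⟩ := Submodule.mem_span_set'.1 hf
  rw [map_sum]
  refine sum_mem fun i _ => ?_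
  obtain ⟨r, hr, h⟩ := (g i).2
  rw [← h, coeffMap_smul_wordSum]
  exact Submodule.smul_mem _ _ (wordSum_mem_polIdeal hr)

theorem exists_addMonoidHom_one_eq_one (L : Type*) [Field L] [CharP L 2] :
    ∃ φ : L →+ ZMod 2, φ 1 = 1 := by
  let _ : Algebra (ZMod 2) L := ZMod.algebra L 2
  obtain ⟨φ, hφ⟩ := LinearMap.exists_leftInverse_of_injective (Algebra.linearMap (ZMod 2) L)
    (LinearMap.ker_eq_bot.2 (FaithfulSMul.algebraMap_injective (ZMod 2) L))
  refine ⟨φ.toAddMonoidHom, ?_⟩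
  simpa using LinearMap.congr_fun hφ 1

end PolIdeal

/-! ### Coefficients of words of length three -/

section Triples

variable {d : ℕ} {K : Type*} [Field K]

/-- The elements of `𝕂⟨X⟩_d` all of whose words have length at least `n`. -/
def lengthGE (K : Type*) [Field K] (d n : ℕ) : Submodule K (FreeAlg K d) where
  carrier := {f | ∀ w, f.coeff w ≠ 0 → n ≤ w.length}
  zero_mem' := by simp
  add_mem' {f g} hf hg w hw := by
    by_cases h : f.coeff w = 0
    · exact hg w fun h' => hw (by simp [h, h'])
    · exact hf w h
  smul_mem' c f hf w hw := hf w fun h => hw (by simp [h])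

theorem mem_lengthGE_one (f : FreeAlg K d) : f ∈ lengthGE K d 1 :=
  fun w _ => Nat.succ_le_succ (Nat.zero_le w.tail.length)

theorem lengthGE_mono {m n : ℕ} (h : m ≤ n) : lengthGE K d n ≤ lengthGE K d m :=
  fun _ hf w hw => h.trans (hf w hw)

theorem mul_mem_lengthGE {m n : ℕ} {f g : FreeAlg K d} (hf : f ∈ lengthGE K d m)
    (hg : g ∈ lengthGE K d n) : f * g ∈ lengthGE K d (m + n) := by
  classical
  intro w hw
  obtain ⟨u, hu, v, hv, rfl⟩ := Finset.mem_mul.1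
    (MonoidAlgebra.support_coeff_mul_subset f g (Finsupp.mem_support_iff.2 hw))
  rw [FreeSemigroup.length_mul]
  exact add_le_add (hf u (Finsupp.mem_support_iff.1 hu)) (hg v (Finsupp.mem_support_iff.1 hv))

theorem coeff_eq_zero_of_mem_lengthGE {n : ℕ} {f : FreeAlg K d} (hf : f ∈ lengthGE K d n)
    {w : FreeSemigroup (Fin d)} (hw : w.length < n) : f.coeff w = 0 := by
  by_contra h
  exact absurd (hf w h) (not_le.2 hw)

/-- The word `x_i x_j x_k`. -/
def tripleWord (i j k : Fin d) : FreeSemigroup (Fin d) :=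
  FreeSemigroup.of i * FreeSemigroup.of j * FreeSemigroup.of k

theorem length_tripleWord (i j k : Fin d) : (tripleWord i j k).length = 3 := rfl

theorem tripleWord_inj {i j k i' j' k' : Fin d} :
    tripleWord i j k = tripleWord i' j' k' ↔ i = i' ∧ j = j' ∧ k = k' := by
  simp [tripleWord, FreeSemigroup.ext_iff, FreeSemigroup.of]

theorem mul_mul_eq_tripleWord {u v w : FreeSemigroup (Fin d)} {i j k : Fin d} :
    u * v * w = tripleWord i j k ↔
      u = FreeSemigroup.of i ∧ v = FreeSemigroup.of j ∧ w = FreeSemigroup.of k := by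
  refine ⟨fun h => ?_, fun ⟨h₁, h₂, h₃⟩ => by rw [h₁, h₂, h₃]; rfl⟩
  obtain ⟨a, u⟩ := u
  obtain ⟨b, v⟩ := v
  obtain ⟨c, w⟩ := w
  have hlen := congrArg FreeSemigroup.length h
  rw [length_tripleWord, FreeSemigroup.length_mul, FreeSemigroup.length_mul] at hlen
  simp only [FreeSemigroup.length] at hlen
  obtain rfl : u = [] := List.eq_nil_of_length_eq_zero (by omega)
  obtain rfl : v = [] := List.eq_nil_of_length_eq_zero (by omega)
  obtain rfl : w = [] := List.eq_nil_of_length_eq_zero (by omega)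
  have := tripleWord_inj.1 (h : tripleWord a b c = _)
  simpa [FreeSemigroup.of] using this

theorem coeff_mul_mul_tripleWord (x y z : FreeAlg K d) (i j k : Fin d) :
    (x * y * z).coeff (tripleWord i j k) = x.coeff (FreeSemigroup.of i) *
      y.coeff (FreeSemigroup.of j) * z.coeff (FreeSemigroup.of k) := by
  classical
  induction x using MonoidAlgebra.induction_linear with
  | zero => simp
  | add x x' hx hx' => simp [add_mul, hx, hx']
  | single u a =>
  induction y using MonoidAlgebra.induction_linear with
  | zero => simp
  | add y y' hy hy' =>
    simp only [mul_add, add_mul, MonoidAlgebra.coeff_add, Finsupp.add_apply, hy, hy']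
  | single v b =>
  induction z using MonoidAlgebra.induction_linear with
  | zero => simp
  | add z z' hz hz' =>
    simp only [mul_add, MonoidAlgebra.coeff_add, Finsupp.add_apply, hz, hz']
  | single w c =>
  simp only [MonoidAlgebra.single_mul_single, MonoidAlgebra.coeff_single, Finsupp.single_apply,
    mul_mul_eq_tripleWord]
  by_cases h₁ : u = FreeSemigroup.of i <;> by_cases h₂ : v = FreeSemigroup.of j <;>
    by_cases h₃ : w = FreeSemigroup.of k <;> simp [h₁, h₂, h₃]

/-- A cube contributes to the words of length three only through its linear part, and the products
of cubes with other elements do not contribute at all. -/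
theorem coeff_tripleWord_add_eq_zero {i j k i' j' k' : Fin d}
    (h : ∀ c : Fin d → K, c i * c j * c k + c i' * c j' * c k' = 0) {f : FreeAlg K d}
    (hf : f ∈ cubeIdeal K d) :
    f.coeff (tripleWord i j k) + f.coeff (tripleWord i' j' k') = 0 := by
  let J : Submodule K (FreeAlg K d) :=
    { carrier := {f | f ∈ lengthGE K d 3 ∧
        f.coeff (tripleWord i j k) + f.coeff (tripleWord i' j' k') = 0}
      zero_mem' := ⟨zero_mem _, by simp⟩
      add_mem' := fun {f g} hf hg => ⟨add_mem hf.1 hg.1, by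
        rw [MonoidAlgebra.coeff_add, Finsupp.add_apply, Finsupp.add_apply, add_add_add_comm, hf.2,
          hg.2, add_zero]⟩
      smul_mem' := fun c f hf => ⟨Submodule.smul_mem _ c hf.1, by
        rw [MonoidAlgebra.coeff_smul, Finsupp.smul_apply, Finsupp.smul_apply, ← smul_add, hf.2,
          smul_zero]⟩ }
  have hJ : ∀ f : FreeAlg K d, f ∈ lengthGE K d (1 + 3) → f ∈ J := fun f hf =>
    ⟨lengthGE_mono (by norm_num) hf, by
      rw [coeff_eq_zero_of_mem_lengthGE hf (by rw [length_tripleWord]; norm_num),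
        coeff_eq_zero_of_mem_lengthGE hf (by rw [length_tripleWord]; norm_num), add_zero]⟩
  have hle : cubeIdeal K d ≤ J := by
    refine sInf_le ⟨fun x => ⟨?_, ?_⟩, fun a f hf => ⟨hJ _ ?_, hJ _ ?_⟩⟩
    · exact mul_mem_lengthGE (mul_mem_lengthGE (mem_lengthGE_one x) (mem_lengthGE_one x))
        (mem_lengthGE_one x)
    · rw [coeff_mul_mul_tripleWord, coeff_mul_mul_tripleWord]
      exact h fun i => x.coeff (FreeSemigroup.of i)
    · exact mul_mem_lengthGE (mem_lengthGE_one a) hf.1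
    · rw [add_comm]
      exact mul_mem_lengthGE hf.1 (mem_lengthGE_one a)
  exact (hle hf).2

theorem coeff_sqPol_letterPoly (i j : Fin d) (w : FreeSemigroup (Fin d)) :
    (sqPol (letterPoly K i) (letterPoly K j)).coeff w =
      (if w = tripleWord i i j then 1 else 0) + (if w = tripleWord i j i then 1 else 0) +
        (if w = tripleWord j i i then 1 else 0) := by
  simp only [sqPol, letterPoly, MonoidAlgebra.single_mul_single, mul_one, MonoidAlgebra.coeff_add,
    MonoidAlgebra.coeff_single, Finsupp.add_apply, Finsupp.single_apply, tripleWord, eq_comm]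
  congr

end Triples

/-! ### A nonzero word of the maximal length -/

section AdjacentPairs

variable {α : Type*} [DecidableEq α] (x : α)

/-- `1` if the junction of `l` and `m` is an occurrence of `x x`, and `0` otherwise. -/
def junction (l m : List α) : ℕ := if l.getLast? = some x ∧ m.head? = some x then 1 else 0

/-- The number of occurrences of `x x` as a factor of a word. -/
def pairCount : List α → ℕ
  | [] => 0
  | a :: l => junction x [a] l + pairCount l

theorem junction_append_right (l : List α) {m : List α} (hm : m ≠ []) (n : List α) :
    junction x l (m ++ n) = junction x l m := by
  rw [junction, junction, List.head?_append_of_ne_nil _ hm]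

theorem pairCount_append (l m : List α) :
    pairCount x (l ++ m) = pairCount x l + junction x l m + pairCount x m := by
  induction l with
  | nil => simp [pairCount, junction]
  | cons a l ih =>
    rw [List.cons_append, pairCount, pairCount, ih]
    rcases eq_or_ne l [] with rfl | hl
    · simp [pairCount, junction]
    · have : junction x (a :: l) m = junction x l m := by
        obtain ⟨b, l, rfl⟩ := List.exists_cons_of_ne_nil hl
        simp [junction, List.getLast?_cons_cons]
      rw [junction_append_right x _ hl, this]
      omega

theorem pairCount_le (l : List α) : pairCount x l ≤ l.count x - 1 := by
  induction l with
  | nil => simp [pairCount]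
  | cons a l ih =>
    have hj : junction x [a] l ≤ 1 := by
      rw [junction]
      split_ifs <;> simp
    by_cases ha : a = x
    · subst ha
      rw [pairCount, List.count_cons_self]
      by_cases hl : l.count a = 0
      · have : junction a [a] l = 0 := by
          rw [junction, if_neg]
          rintro ⟨-, h⟩
          exact List.count_eq_zero.1 hl (List.mem_of_mem_head? h)
        omega
      · omega
    · have : junction x [a] l = 0 := by simp [junction, ha]
      rw [pairCount, List.count_cons_of_ne ha, this]
      omega

/-- In the quadratic polarization of the cube, the number of pairs has the parity that it has in the
word in which the quadratic variable is deleted. -/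
theorem pairCount_sq (a b : List α) {u v : List α} (hu : u ≠ []) (hv : v ≠ []) :
    pairCount x (a ++ (u ++ (u ++ (v ++ b)))) + pairCount x (a ++ (u ++ (v ++ (u ++ b)))) +
      pairCount x (a ++ (v ++ (u ++ (u ++ b)))) = pairCount x (a ++ (v ++ b)) +
        2 * (pairCount x a + 3 * pairCount x u + pairCount x v + pairCount x b +
          junction x a u + junction x u u + junction x u v + junction x v u + junction x u b) := by
  simp only [pairCount_append, junction_append_right x _ hu, junction_append_right x _ hv]
  ring

theorem pairCount_lin (a b : List α) {u v w : List α} (hu : u ≠ []) (hv : v ≠ []) (hw : w ≠ []) :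
    pairCount x (a ++ (u ++ (v ++ (w ++ b)))) + pairCount x (a ++ (u ++ (w ++ (v ++ b)))) +
      pairCount x (a ++ (v ++ (u ++ (w ++ b)))) + pairCount x (a ++ (v ++ (w ++ (u ++ b)))) +
      pairCount x (a ++ (w ++ (u ++ (v ++ b)))) + pairCount x (a ++ (w ++ (v ++ (u ++ b)))) =
        2 * (3 * (pairCount x a + pairCount x u + pairCount x v + pairCount x w + pairCount x b) +
          junction x a u + junction x a v + junction x a w + junction x u v + junction x v u +
          junction x u w + junction x w u + junction x v w + junction x w v + junction x u b +
          junction x v b + junction x w b) := by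
  simp only [pairCount_append, junction_append_right x _ hu, junction_append_right x _ hv,
    junction_append_right x _ hw]
  ring

end AdjacentPairs

section LowerBound

variable {d : ℕ}

/-- A generator of `polIdeal`, with the words that it was multiplied by collected into a left factor
`a` and a right factor `b`, which may be empty. -/
theorem CubeRel.exists_context {r : Multiset (FreeSemigroup (Fin d))} (hr : CubeRel r) :
    ∃ a b : List (Fin d),
      (∃ u ≠ [], r.map FreeSemigroup.toList = {a ++ (u ++ (u ++ (u ++ b)))}) ∨
      (∃ u ≠ [], ∃ v ≠ [], r.map FreeSemigroup.toList =
        {a ++ (u ++ (u ++ (v ++ b))), a ++ (u ++ (v ++ (u ++ b))),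
          a ++ (v ++ (u ++ (u ++ b)))}) ∨
      ∃ u ≠ [], ∃ v ≠ [], ∃ w ≠ [], r.map FreeSemigroup.toList =
        {a ++ (u ++ (v ++ (w ++ b))), a ++ (u ++ (w ++ (v ++ b))),
          a ++ (v ++ (u ++ (w ++ b))), a ++ (v ++ (w ++ (u ++ b))),
          a ++ (w ++ (u ++ (v ++ b))), a ++ (w ++ (v ++ (u ++ b)))} := by
  induction hr with
  | cube u =>
    exact ⟨[], [], Or.inl ⟨_, u.toList_ne_nil, by simp [FreeSemigroup.toList_mul]⟩⟩
  | sq u v =>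
    exact ⟨[], [], Or.inr (Or.inl ⟨_, u.toList_ne_nil, _, v.toList_ne_nil,
      by simp [FreeSemigroup.toList_mul]⟩)⟩
  | lin u v w =>
    exact ⟨[], [], Or.inr (Or.inr ⟨_, u.toList_ne_nil, _, v.toList_ne_nil, _, w.toList_ne_nil,
      by simp [FreeSemigroup.toList_mul]⟩)⟩
  | mul_left c r _ ih =>
    have hmap : (r.map (c * ·)).map FreeSemigroup.toList =
        (r.map FreeSemigroup.toList).map (c.toList ++ ·) := by
      simp only [Multiset.map_map, Function.comp_def, FreeSemigroup.toList_mul]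
    obtain ⟨a, b, ⟨u, hu, h⟩ | ⟨u, hu, v, hv, h⟩ | ⟨u, hu, v, hv, w, hw, h⟩⟩ := ih
    · exact ⟨c.toList ++ a, b, Or.inl ⟨u, hu, by rw [hmap, h]; simp⟩⟩
    · exact ⟨c.toList ++ a, b, Or.inr (Or.inl ⟨u, hu, v, hv, by rw [hmap, h]; simp⟩)⟩
    · exact ⟨c.toList ++ a, b, Or.inr (Or.inr ⟨u, hu, v, hv, w, hw, by rw [hmap, h]; simp⟩)⟩
  | mul_right c r _ ih =>
    have hmap : (r.map (· * c)).map FreeSemigroup.toList =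
        (r.map FreeSemigroup.toList).map (· ++ c.toList) := by
      simp only [Multiset.map_map, Function.comp_def, FreeSemigroup.toList_mul]
    obtain ⟨a, b, ⟨u, hu, h⟩ | ⟨u, hu, v, hv, h⟩ | ⟨u, hu, v, hv, w, hw, h⟩⟩ := ih
    · exact ⟨a, b ++ c.toList, Or.inl ⟨u, hu, by rw [hmap, h]; simp⟩⟩
    · exact ⟨a, b ++ c.toList, Or.inr (Or.inl ⟨u, hu, v, hv, by rw [hmap, h]; simp⟩)⟩
    · exact ⟨a, b ++ c.toList, Or.inr (Or.inr ⟨u, hu, v, hv, w, hw, by rw [hmap, h]; simp⟩)⟩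

/-- The weight of a word that is used to detect `τ`: the number of occurrences of `x x`, for the
rearrangements of `τ` only. -/
def pairWeight (K : Type*) [Field K] (x : Fin d) (τ l : List (Fin d)) : K :=
  if l.Perm τ then (pairCount x l : K) else 0

theorem pairWeight_of_perm {K : Type*} [Field K] {x : Fin d} {τ l m : List (Fin d)}
    (h : l.Perm m) : pairWeight K x τ l = if m.Perm τ then (pairCount x l : K) else 0 := by
  have : l.Perm τ ↔ m.Perm τ := ⟨fun h' => h.symm.trans h', fun h' => h.trans h'⟩
  simp only [pairWeight, this]

/-- The weights sum to zero over every generator of `polIdeal`, provided that deleting a doubled part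
from a rearrangement of `τ` always leaves an even number of pairs `x x`. -/
theorem CubeRel.sum_pairWeight {K : Type*} [Field K] [CharP K 2] {x : Fin d} {τ : List (Fin d)}
    (hτ : ∀ u l : List (Fin d), u ≠ [] → (u ++ (u ++ l)).Perm τ → Even (pairCount x l))
    {r : Multiset (FreeSemigroup (Fin d))} (hr : CubeRel r) :
    (r.map fun w => pairWeight K x τ w.toList).sum = 0 := by
  have h2 : (2 : K) = 0 := CharTwo.two_eq_zero
  have hmap : (r.map fun w => pairWeight K x τ w.toList) =
      (r.map FreeSemigroup.toList).map (pairWeight K x τ) := by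
    rw [Multiset.map_map]; rfl
  have hsq : ∀ a b u v : List (Fin d), u ≠ [] → v ≠ [] →
      pairWeight K x τ (a ++ (u ++ (u ++ (v ++ b)))) +
        pairWeight K x τ (a ++ (u ++ (v ++ (u ++ b)))) +
        pairWeight K x τ (a ++ (v ++ (u ++ (u ++ b)))) = 0 := by
    intro a b u v hu hv
    have p₁ : (a ++ (u ++ (u ++ (v ++ b)))).Perm (u ++ (u ++ (a ++ (v ++ b)))) := by
      rw [← Multiset.coe_eq_coe]; simp only [← Multiset.coe_add]; abel
    have p₂ : (a ++ (u ++ (v ++ (u ++ b)))).Perm (u ++ (u ++ (a ++ (v ++ b)))) := by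
      rw [← Multiset.coe_eq_coe]; simp only [← Multiset.coe_add]; abel
    have p₃ : (a ++ (v ++ (u ++ (u ++ b)))).Perm (u ++ (u ++ (a ++ (v ++ b)))) := by
      rw [← Multiset.coe_eq_coe]; simp only [← Multiset.coe_add]; abel
    rw [pairWeight_of_perm p₁, pairWeight_of_perm p₂, pairWeight_of_perm p₃]
    split_ifs with h
    · obtain ⟨n, hn⟩ := hτ u _ hu h
      have e := congrArg (Nat.cast : ℕ → K) (pairCount_sq x a b hu hv)
      rw [hn] at e
      push_cast at e
      rw [e]
      linear_combination ((n : K) + (pairCount x a + 3 * pairCount x u + pairCount x v +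
        pairCount x b + junction x a u + junction x u u + junction x u v + junction x v u +
        junction x u b)) * h2
    · simp
  rw [hmap]
  obtain ⟨a, b, ⟨u, hu, h⟩ | ⟨u, hu, v, hv, h⟩ | ⟨u, hu, v, hv, w, hw, h⟩⟩ := hr.exists_context
  · rw [h, Multiset.map_singleton, Multiset.sum_singleton]
    linear_combination hsq a b u u hu hu - pairWeight K x τ (a ++ (u ++ (u ++ (u ++ b)))) * h2
  · rw [h, ← hsq a b u v hu hv]
    simp [add_assoc]
  · have perm : ∀ {p q s : List (Fin d)}, (p ++ (q ++ s)).Perm (u ++ (v ++ w)) →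
        (a ++ (p ++ (q ++ (s ++ b)))).Perm (a ++ (u ++ (v ++ (w ++ b)))) := by
      intro p q s hp
      simpa using ((hp.append_right b).append_left a)
    have q₁ : (u ++ (w ++ v)).Perm (u ++ (v ++ w)) := by
      rw [← Multiset.coe_eq_coe]; simp only [← Multiset.coe_add]; abel
    have q₂ : (v ++ (u ++ w)).Perm (u ++ (v ++ w)) := by
      rw [← Multiset.coe_eq_coe]; simp only [← Multiset.coe_add]; abel
    have q₃ : (v ++ (w ++ u)).Perm (u ++ (v ++ w)) := by
      rw [← Multiset.coe_eq_coe]; simp only [← Multiset.coe_add]; abel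
    have q₄ : (w ++ (u ++ v)).Perm (u ++ (v ++ w)) := by
      rw [← Multiset.coe_eq_coe]; simp only [← Multiset.coe_add]; abel
    have q₅ : (w ++ (v ++ u)).Perm (u ++ (v ++ w)) := by
      rw [← Multiset.coe_eq_coe]; simp only [← Multiset.coe_add]; abel
    rw [h]
    simp only [Multiset.insert_eq_cons, Multiset.map_cons, Multiset.sum_cons,
      Multiset.map_singleton, Multiset.sum_singleton]
    rw [pairWeight_of_perm (perm q₁), pairWeight_of_perm (perm q₂), pairWeight_of_perm (perm q₃),
      pairWeight_of_perm (perm q₄), pairWeight_of_perm (perm q₅),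
      pairWeight_of_perm (List.Perm.refl _)]
    split_ifs
    · have e := congrArg (Nat.cast : ℕ → K) (pairCount_lin x a b hu hv hw)
      push_cast at e
      rw [h2, zero_mul] at e
      simpa only [add_assoc] using e
    · simp

theorem wordFunctional_eq_zero {K : Type*} [Field K] (h : FreeSemigroup (Fin d) → K)
    (hh : ∀ r, CubeRel r → (r.map h).sum = 0) {f : FreeAlg K d} (hf : f ∈ polIdeal K d) :
    Finsupp.linearCombination K h f.coeff = 0 := by
  have hr : ∀ r : Multiset (FreeSemigroup (Fin d)),
      Finsupp.linearCombination K h (wordSum K r).coeff = (r.map h).sum := by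
    intro r
    induction r using Multiset.induction_on with
    | empty => simp [wordSum]
    | cons w r ih =>
      rw [Multiset.map_cons, Multiset.sum_cons, ← ih, wordSum, wordSum, Multiset.map_cons,
        Multiset.sum_cons, MonoidAlgebra.coeff_add, map_add]
      simp
  induction hf using Submodule.span_induction with
  | mem f hf =>
    obtain ⟨r, h', rfl⟩ := hf
    rw [hr, hh r h']
  | zero => simp
  | add f g _ _ hf hg => rw [MonoidAlgebra.coeff_add, map_add, hf, hg, add_zero]
  | smul c f _ hf => rw [MonoidAlgebra.coeff_smul, map_smul, hf, smul_zero]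

theorem NilAlg.word_ne_zero {K : Type*} [Field K] [CharP K 2] {x : Fin d}
    {w : FreeSemigroup (Fin d)} (hodd : Odd (pairCount x w.toList))
    (hτ : ∀ u l : List (Fin d), u ≠ [] → (u ++ (u ++ l)).Perm w.toList → Even (pairCount x l)) :
    NilAlg.word K w ≠ 0 := by
  intro h0
  have h := wordFunctional_eq_zero _ (fun r hr => CubeRel.sum_pairWeight (K := K) hτ hr)
    (cubeIdeal_le_polIdeal K d (NilAlg.mk_eq_zero.1 h0))
  obtain ⟨n, hn⟩ := hodd
  simp [pairWeight, hn, CharTwo.two_eq_zero] at h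

/-- The word is `x₁ x₁ x₂ x₁ x₃ ⋯ x_d` for `d ≥ 3`, and `x₁ x₁ x₂ x₁ x₂` for `d = 2`. -/
theorem exists_nonzero_word (d : ℕ) (hd : 2 ≤ d) (K : Type*) [Field K] [CharP K 2] :
    ∃ w : FreeSemigroup (Fin d), w.length + 1 = (if d = 2 then 6 else d + 3) ∧
      NilAlg.word K w ≠ 0 := by
  obtain ⟨n, rfl⟩ : ∃ n, d = n + 2 := ⟨d - 2, by omega⟩
  -- If the doubled part `u` contains the letter `0`, at most one `0` is left for `l`.
  have key : ∀ τ u l : List (Fin (n + 2)), τ.count 0 = 3 → (u ++ (u ++ l)).Perm τ →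
      (0 ∉ u → Even (pairCount 0 l)) → Even (pairCount 0 l) := by
    intro τ u l hτ hp hu
    by_cases h0 : 0 ∈ u
    · have h₁ := List.count_pos_iff.2 h0
      have h₂ := hp.count_eq 0
      rw [hτ, List.count_append, List.count_append] at h₂
      have h₃ := pairCount_le 0 l
      have : pairCount 0 l = 0 := by omega
      simp [this]
    · exact hu h0
  split_ifs with h2
  · obtain rfl : n = 0 := by omega
    refine ⟨⟨0, [0, 1, 0, 1]⟩, rfl, NilAlg.word_ne_zero (x := 0) (by decide) ?_⟩
    intro u l hu hp
    refine key _ u l (by decide) hp fun h0 => ?_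
    have h₁ := hp.count_eq 0
    have h₂ := hp.length_eq
    rw [List.count_append, List.count_append, List.count_eq_zero.2 h0] at h₁
    have h₃ : l.count 0 = 3 := by simpa [FreeSemigroup.toList] using h₁
    have h₄ := List.length_pos_iff.2 hu
    have h₅ : l.length = 3 := by
      have := List.count_le_length (a := 0) (l := l)
      simp [FreeSemigroup.toList] at h₂
      omega
    have h₆ : l = List.replicate 3 0 := by
      refine List.eq_replicate_iff.2 ⟨h₅, fun b hb => ?_⟩
      exact ((List.count_eq_length.1 (h₃.trans h₅.symm)) b hb).symm
    rw [h₆]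
    decide
  · let t : List (Fin (n + 2)) := List.ofFn fun m : Fin n => m.succ.succ
    have ht0 : (0 : Fin (n + 2)) ∉ t := by
      simp [t, List.mem_ofFn, Fin.succ_ne_zero]
    have ht1 : (1 : Fin (n + 2)) ∉ t := by
      rw [List.mem_ofFn]
      rintro ⟨m, hm⟩
      exact Fin.succ_ne_zero m (Fin.succ_injective _ hm)
    have ht : t.Nodup := List.nodup_ofFn.2 ((Fin.succ_injective _).comp (Fin.succ_injective _))
    have hτ0 : (0 :: 0 :: 1 :: 0 :: t).count 0 = 3 := by
      simp [List.count_eq_zero.2 ht0]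
    refine ⟨⟨0, 0 :: 1 :: 0 :: t⟩, by simp [FreeSemigroup.length, t],
      NilAlg.word_ne_zero (x := 0) ?_ ?_⟩
    · have e : pairCount 0 t = 0 := by
        have := pairCount_le 0 t
        rw [List.count_eq_zero.2 ht0] at this
        omega
      have e' : junction 0 [0] t = 0 := by
        rw [junction, if_neg]
        rintro ⟨-, h⟩
        exact ht0 (List.mem_of_mem_head? h)
      have : pairCount 0 (0 :: 0 :: 1 :: 0 :: t) = 1 := by
        simp only [pairCount, e, e']
        simp [junction]
      rw [FreeSemigroup.toList, this]
      decide
    · intro u l hu hp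
      refine key _ u l hτ0 hp fun h0 => ?_
      -- A letter of `u`, which is not `0`, would occur twice in the word.
      exfalso
      obtain ⟨y, hy⟩ := List.exists_mem_of_ne_nil u hu
      have hy0 : y ≠ 0 := fun h => h0 (h ▸ hy)
      have h₁ := hp.count_eq y
      have h₂ := List.count_pos_iff.2 hy
      rw [List.count_append, List.count_append, FreeSemigroup.toList] at h₁
      have h₃ := List.nodup_iff_count_le_one.1 ht y
      by_cases hy1 : y = 1
      · subst hy1
        have := List.count_eq_zero.2 ht1
        simp [this] at h₁
        omega
      · simp [Ne.symm hy0, Ne.symm hy1] at h₁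
        omega

end LowerBound

/-! ### Bases of words -/

section WordBases

variable {d : ℕ} {K : Type*} [Field K]

theorem linearCombination_word (l : FreeSemigroup (Fin d) →₀ K) :
    Finsupp.linearCombination K (NilAlg.word K) l = NilAlg.mk K d (MonoidAlgebra.ofCoeff l) := by
  induction l using Finsupp.induction_linear with
  | zero => simp
  | add f g hf hg => rw [map_add, MonoidAlgebra.ofCoeff_add, map_add, hf, hg]
  | single w c =>
    rw [Finsupp.linearCombination_single, NilAlg.word, ← map_smul, ← single_eq_smul,
      MonoidAlgebra.ofCoeff_single]

theorem linearIndependent_word_iff (B : Set (FreeSemigroup (Fin d))) :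
    LinearIndependent K (fun w : B => NilAlg.word K (w : FreeSemigroup (Fin d))) ↔
      ∀ f : FreeAlg K d, (∀ w, f.coeff w ≠ 0 → w ∈ B) → f ∈ cubeIdeal K d → f = 0 := by
  have h := linearIndepOn_iff (R := K) (s := B)
    (v := fun w : FreeSemigroup (Fin d) => NilAlg.word K w)
  refine h.trans ⟨fun H f hf h0 => ?_, fun H l hl h0 => ?_⟩
  · refine MonoidAlgebra.coeff_eq_zero.1 (H f.coeff ?_ ?_)
    · exact (Finsupp.mem_supported' K _).2 fun w hw => by
        by_contra h'
        exact hw (hf w h')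
    · exact (linearCombination_word f.coeff).trans (NilAlg.mk_eq_zero.2 h0)
  · refine MonoidAlgebra.ofCoeff_eq_zero.1 (H (MonoidAlgebra.ofCoeff l) ?_ ?_)
    · intro w hw
      by_contra h'
      exact hw ((Finsupp.mem_supported' K _).1 hl w h')
    · exact NilAlg.mk_eq_zero.1 ((linearCombination_word l).symm.trans h0)

theorem span_range_word : Submodule.span K (Set.range (NilAlg.word K (d := d))) = ⊤ := by
  rw [eq_top_iff]
  rintro x -
  obtain ⟨f, rfl⟩ := NilAlg.mk_surjective K d x
  have h := linearCombination_word f.coeff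
  rw [show MonoidAlgebra.ofCoeff f.coeff = f from rfl] at h
  rw [← h]
  rw [← Finsupp.range_linearCombination]
  exact ⟨f.coeff, rfl⟩

theorem word_mem_span_iff (B : Set (FreeSemigroup (Fin d))) (w : FreeSemigroup (Fin d)) :
    NilAlg.word K w ∈ Submodule.span K (NilAlg.word K '' B) ↔
      ∃ f : FreeAlg K d, (∀ w, f.coeff w ≠ 0 → w ∈ B) ∧
        MonoidAlgebra.single w 1 - f ∈ cubeIdeal K d := by
  rw [Finsupp.mem_span_image_iff_linearCombination]
  constructor
  · rintro ⟨l, hl, h⟩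
    refine ⟨MonoidAlgebra.ofCoeff l, fun v hv => ?_, ?_⟩
    · by_contra h'
      exact hv ((Finsupp.mem_supported' K _).1 hl v h')
    · rw [← NilAlg.mk_eq_mk, ← linearCombination_word l]
      exact h.symm
  · rintro ⟨f, hf, h⟩
    refine ⟨f.coeff, (Finsupp.mem_supported' K _).2 fun v hv => ?_, ?_⟩
    · by_contra h'
      exact hv (hf v h')
    · rw [linearCombination_word, NilAlg.word]
      exact (NilAlg.mk_eq_mk.2 h).symm

theorem isWordBasis_iff (B : Set (FreeSemigroup (Fin d))) : IsWordBasis K B ↔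
    (∀ f : FreeAlg K d, (∀ w, f.coeff w ≠ 0 → w ∈ B) → f ∈ cubeIdeal K d → f = 0) ∧
      ∀ w, ∃ f : FreeAlg K d, (∀ w, f.coeff w ≠ 0 → w ∈ B) ∧
        MonoidAlgebra.single w 1 - f ∈ cubeIdeal K d := by
  rw [IsWordBasis, linearIndependent_word_iff]
  refine and_congr_right fun _ => ⟨fun h w => ?_, fun h => ?_⟩
  · rw [← word_mem_span_iff, h]
    trivial
  · rw [eq_top_iff, ← span_range_word, Submodule.span_le]
    rintro _ ⟨w, rfl⟩
    exact (word_mem_span_iff B w).2 (h w)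

theorem mem_sandwichWords {w : FreeSemigroup (Fin d)} :
    w ∈ sandwichWords d ↔ ∃ i j, i < j ∧ w = tripleWord i j i := Iff.rfl

/-- Modulo `x_i² x_j + x_i x_j x_i + x_j x_i²`, the words `x_i x_j x_i` are superfluous. -/
theorem exists_isWordBasis_disjoint (L : Type*) [Field L] [Infinite L] (d : ℕ) :
    ∃ B : Set (FreeSemigroup (Fin d)), IsWordBasis L B ∧ Disjoint B (sandwichWords d) := by
  obtain ⟨B, hB, -, hspan, hli⟩ := exists_linearIndepOn_extension
    (linearIndepOn_empty L (NilAlg.word L (d := d))) (Set.empty_subset (sandwichWords d)ᶜ)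
  refine ⟨B, ⟨hli, ?_⟩, Set.disjoint_left.2 fun w hw => hB hw⟩
  have hle : ∀ w ∉ sandwichWords d,
      NilAlg.word L w ∈ Submodule.span L (NilAlg.word L '' B) :=
    fun w hw => hspan ⟨w, hw, rfl⟩
  rw [eq_top_iff, ← span_range_word, Submodule.span_le]
  rintro _ ⟨w, rfl⟩
  by_cases hw : w ∈ sandwichWords d
  · obtain ⟨i, j, hij, rfl⟩ := mem_sandwichWords.1 hw
    have hns : ∀ a b c : Fin d, a ≠ c → tripleWord a b c ∉ sandwichWords d := by
      intro a b c hac h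
      obtain ⟨i, j, -, h⟩ := mem_sandwichWords.1 h
      obtain ⟨h₁, -, h₂⟩ := tripleWord_inj.1 h
      exact hac (h₁.trans h₂.symm)
    have h₁ := hle _ (hns i i j hij.ne)
    have h₂ := hle _ (hns j i i hij.ne')
    have h := NilAlg.sqPol_eq_zero (NilAlg.word L (FreeSemigroup.of i))
      (NilAlg.word L (FreeSemigroup.of j))
    simp only [sqPol, ← NilAlg.word_mul] at h
    have e : NilAlg.word L (tripleWord i j i) =
        -NilAlg.word L (tripleWord i i j) - NilAlg.word L (tripleWord j i i) := by
      rw [eq_sub_iff_add_eq, eq_neg_iff_add_eq_zero, ← h]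
      simp only [tripleWord]
      abel
    rw [SetLike.mem_coe, e]
    exact sub_mem (neg_mem h₁) h₂
  · exact hle w hw

/-- If a basis over `L` avoids `x_i x_j x_i`, it must contain the other two words of the relation
`x_i² x_j + x_i x_j x_i + x_j x_i² = 0`, which is the only one in its multidegree. -/
theorem tripleWord_mem_of_isWordBasis {L : Type*} [Field L] [CharP L 2]
    {B : Set (FreeSemigroup (Fin d))} (hB : IsWordBasis L B) (hS : Disjoint B (sandwichWords d))
    {i j : Fin d} (hij : i < j) : tripleWord i i j ∈ B ∧ tripleWord j i i ∈ B := by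
  have hiji : tripleWord i j i ∉ B := fun h => Set.disjoint_left.1 hS h ⟨i, j, hij, rfl⟩
  have key : ∀ a b c : Fin d, tripleWord a b c ≠ tripleWord i j i →
      (∀ x : Fin d → L, x a * x b * x c + x i * x j * x i = 0) → tripleWord a b c ∈ B := by
    intro a b c hne hx
    obtain ⟨f, hf, hmem⟩ := ((isWordBasis_iff B).1 hB).2 (tripleWord a b c)
    have h := coeff_tripleWord_add_eq_zero hx hmem
    by_contra hnot
    have h₁ : f.coeff (tripleWord a b c) = 0 := by
      by_contra h'
      exact hnot (hf _ h')
    have h₂ : f.coeff (tripleWord i j i) = 0 := by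
      by_contra h'
      exact hiji (hf _ h')
    rw [MonoidAlgebra.coeff_sub, Finsupp.sub_apply, Finsupp.sub_apply, h₁, h₂] at h
    simp [hne] at h
  constructor
  · refine key i i j (fun h => hij.ne (tripleWord_inj.1 h).2.1) fun x => ?_
    rw [mul_right_comm, CharTwo.add_self_eq_zero]
  · refine key j i i (fun h => hij.ne' (tripleWord_inj.1 h).1) fun x => ?_
    rw [mul_comm (x j), CharTwo.add_self_eq_zero]

/-- The combination of the polarizations `x_i² x_j + x_i x_j x_i + x_j x_i²` with coefficients
`c`. -/
noncomputable def sqPolComb (K : Type*) [Field K] {d : ℕ}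
    (c : {p : Fin d × Fin d // p.1 < p.2} → K) : FreeAlg K d :=
  ∑ p, c p • sqPol (letterPoly K p.1.1) (letterPoly K p.1.2)

theorem coeff_sqPolComb (c : {p : Fin d × Fin d // p.1 < p.2} → K) (w : FreeSemigroup (Fin d)) :
    (sqPolComb K c).coeff w =
      ∑ p, c p * (sqPol (letterPoly K p.1.1) (letterPoly K p.1.2)).coeff w := by
  simp [sqPolComb]

theorem coeff_sqPolComb_sandwich (c : {p : Fin d × Fin d // p.1 < p.2} → K)
    (p : {p : Fin d × Fin d // p.1 < p.2}) :
    (sqPolComb K c).coeff (tripleWord p.1.1 p.1.2 p.1.1) = c p := by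
  obtain ⟨⟨i, j⟩, hij⟩ := p
  have hij' : i < j := hij
  rw [coeff_sqPolComb, Finset.sum_eq_single ⟨(i, j), hij⟩]
  · rw [coeff_sqPol_letterPoly]
    simp [tripleWord_inj, hij'.ne, hij'.ne']
  · rintro ⟨⟨i', j'⟩, hp⟩ - hne
    have h₁ : tripleWord i j i ≠ tripleWord i' i' j' := by
      rw [Ne, tripleWord_inj]
      rintro ⟨h, h', -⟩
      exact hij'.ne (h.trans h'.symm)
    have h₂ : tripleWord i j i ≠ tripleWord i' j' i' := by
      rw [Ne, tripleWord_inj]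
      rintro ⟨rfl, rfl, -⟩
      exact hne rfl
    have h₃ : tripleWord i j i ≠ tripleWord j' i' i' := by
      rw [Ne, tripleWord_inj]
      rintro ⟨-, h, h'⟩
      exact hij'.ne (h'.trans h.symm)
    simp [coeff_sqPol_letterPoly, h₁, h₂, h₃]
  · simp

theorem coeff_sqPolComb_swap (c : {p : Fin d × Fin d // p.1 < p.2} → K)
    (p : {p : Fin d × Fin d // p.1 < p.2}) :
    (sqPolComb K c).coeff (tripleWord p.1.2 p.1.1 p.1.2) = 0 := by
  rw [coeff_sqPolComb, Finset.sum_eq_zero]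
  rintro ⟨⟨i, j⟩, hij⟩ -
  rw [coeff_sqPol_letterPoly]
  have hp := p.2
  have h₁ : tripleWord p.1.2 p.1.1 p.1.2 ≠ tripleWord i i j := by
    rw [Ne, tripleWord_inj]
    rintro ⟨h, h', -⟩
    exact hp.ne (h'.trans h.symm)
  have h₂ : tripleWord p.1.2 p.1.1 p.1.2 ≠ tripleWord i j i := by
    rw [Ne, tripleWord_inj]
    rintro ⟨h, h', -⟩
    rw [h, h'] at hp
    exact lt_asymm hp hij
  have h₃ : tripleWord p.1.2 p.1.1 p.1.2 ≠ tripleWord j i i := by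
    rw [Ne, tripleWord_inj]
    rintro ⟨-, h, h'⟩
    exact hp.ne (h.trans h'.symm)
  simp [h₁, h₂, h₃]

/-- Over `𝔽₂`, the sum of the coefficients at `x_i x_j x_i` and `x_j x_i x_j` vanishes on the ideal
of cubes, because `a² b + a b² = 0` for all scalars `a` and `b`. -/
theorem coeff_sandwich_add_swap {f : FreeAlg (ZMod 2) d} (hf : f ∈ cubeIdeal (ZMod 2) d)
    (i j : Fin d) : f.coeff (tripleWord i j i) + f.coeff (tripleWord j i j) = 0 := by
  refine coeff_tripleWord_add_eq_zero (fun c => ?_) hf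
  generalize c i = a
  generalize c j = b
  revert a b
  decide

theorem isWordBasis_union_sandwichWords {L : Type*} [Field L] [Infinite L] [CharP L 2]
    {B : Set (FreeSemigroup (Fin d))} (hB : IsWordBasis L B)
    (hS : Disjoint B (sandwichWords d)) : IsWordBasis (ZMod 2) (B ∪ sandwichWords d) := by
  classical
  have hmem := fun i j hij => tripleWord_mem_of_isWordBasis hB hS (i := i) (j := j) hij
  obtain ⟨hli, hspan⟩ := (isWordBasis_iff B).1 hB
  -- The polarizations in the letters are combinations of words in `B` and sandwich words.
  have hsupp : ∀ p : {p : Fin d × Fin d // p.1 < p.2}, ∀ w,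
      (sqPol (letterPoly (ZMod 2) p.1.1) (letterPoly (ZMod 2) p.1.2)).coeff w ≠ 0 →
        w ∈ B ∨ w = tripleWord p.1.1 p.1.2 p.1.1 := by
    intro p w hw
    rw [coeff_sqPol_letterPoly] at hw
    by_contra! h
    have h₁ : w ≠ tripleWord p.1.1 p.1.1 p.1.2 := fun e => h.1 (e ▸ (hmem _ _ p.2).1)
    have h₂ : w ≠ tripleWord p.1.2 p.1.1 p.1.1 := fun e => h.1 (e ▸ (hmem _ _ p.2).2)
    simp [h₁, h₂, h.2] at hw
  refine (isWordBasis_iff _).2 ⟨fun f hf h0 => ?_, fun w => ?_⟩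
  · -- Replace each sandwich word in `f` by the other two words of its relation.
    let c : {p : Fin d × Fin d // p.1 < p.2} → ZMod 2 :=
      fun p => f.coeff (tripleWord p.1.1 p.1.2 p.1.1)
    let g : FreeAlg (ZMod 2) d := f + sqPolComb (ZMod 2) c
    have hg : ∀ w, g.coeff w = f.coeff w + (sqPolComb (ZMod 2) c).coeff w := fun w => by simp [g]
    have hgI : g ∈ polIdeal (ZMod 2) d :=
      add_mem (cubeIdeal_le_polIdeal _ _ h0)
        (sum_mem fun p _ => Submodule.smul_mem _ _ (sqPol_mem_polIdeal _ _))
    have hgB : ∀ w, g.coeff w ≠ 0 → w ∈ B := by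
      intro w hw
      by_contra hwB
      refine hw ?_
      rw [hg]
      by_cases hwS : w ∈ sandwichWords d
      · obtain ⟨i, j, hij, rfl⟩ := mem_sandwichWords.1 hwS
        rw [coeff_sqPolComb_sandwich c ⟨(i, j), hij⟩]
        exact CharTwo.add_self_eq_zero _
      · have hfw : f.coeff w = 0 := by
          by_contra h
          exact (hf w h).elim hwB hwS
        rw [hfw, zero_add, coeff_sqPolComb]
        refine Finset.sum_eq_zero fun p _ => ?_
        rw [mul_eq_zero]
        right
        by_contra h
        rcases hsupp _ _ h with h | rfl
        · exact hwB h
        · exact hwS ⟨_, _, p.2, rfl⟩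
    have hg0 : g = 0 := by
      let φ : ZMod 2 →+ L := (ZMod.castHom (dvd_refl 2) L : ZMod 2 →+* L).toAddMonoidHom
      have hφ : Function.Injective φ := (ZMod.castHom (dvd_refl 2) L : ZMod 2 →+* L).injective
      have h := hli (coeffMap φ g) (fun w hw => hgB w fun h' => hw (by
        rw [coeff_coeffMap, h', map_zero])) (by
          rw [← polIdeal_eq_cubeIdeal]
          exact coeffMap_mem_polIdeal φ hgI)
      ext w
      refine hφ ?_
      rw [← coeff_coeffMap, h]
      simp
    -- The coefficients of `x_i x_j x_i` in `f` vanish, because `f` is in the ideal over `𝔽₂`.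
    have hc : c = 0 := by
      funext p
      have h₁ := coeff_sandwich_add_swap h0 p.1.1 p.1.2
      have h₂ := hg (tripleWord p.1.2 p.1.1 p.1.2)
      rw [hg0, coeff_sqPolComb_swap, add_zero] at h₂
      rwa [← h₂, MonoidAlgebra.coeff_zero, Finsupp.zero_apply, add_zero] at h₁
    ext w
    have h := hg w
    rw [hg0] at h
    simpa [hc, coeff_sqPolComb] using h.symm
  · obtain ⟨f, hf, hfI⟩ := hspan w
    obtain ⟨φ, hφ⟩ := exists_addMonoidHom_one_eq_one L
    rw [← polIdeal_eq_cubeIdeal] at hfI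
    have h := coeffMap_mem_polIdeal φ hfI
    rw [map_sub, coeffMap_single, hφ] at h
    obtain ⟨u, hu, s, hs, hus⟩ := Submodule.mem_sup.1 (polIdeal_le_cubeIdeal_sup d h)
    obtain ⟨c, rfl⟩ := (Submodule.mem_span_range_iff_exists_fun _).1 hs
    refine ⟨coeffMap φ f + _, fun v hv => ?_, by rwa [← sub_sub, ← hus, add_sub_cancel_right]⟩
    by_contra hvB
    refine hv ?_
    rw [MonoidAlgebra.coeff_add, Finsupp.add_apply, coeff_coeffMap]
    have h₁ : f.coeff v = 0 := by
      by_contra h'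
      exact hvB (Or.inl (hf v h'))
    rw [h₁, map_zero, zero_add, MonoidAlgebra.coeff_sum, Finsupp.finsetSum_apply]
    refine Finset.sum_eq_zero fun p _ => ?_
    rw [MonoidAlgebra.coeff_smul, Finsupp.smul_apply, smul_eq_mul, mul_eq_zero]
    right
    by_contra h'
    rcases hsupp p v h' with h' | rfl
    · exact hvB (Or.inl h')
    · exact hvB (Or.inr ⟨_, _, p.2, rfl⟩)

end WordBases

/-! ### The nilpotency degree -/

section NilDegree

variable {d : ℕ} {K : Type*} [Field K]

theorem consecProd_succ_eq_mul {S : Type*} [Semigroup S] (a : ℕ → S) (k : ℕ) :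
    consecProd a (k + 1) = a 0 * consecProd (fun n => a (n + 1)) k := by
  induction k with
  | zero => rfl
  | succ k ih => rw [consecProd, ih, mul_assoc]; rfl

theorem mk_consecProd (b : ℕ → FreeAlg K d) (k : ℕ) :
    NilAlg.mk K d (consecProd b k) = consecProd (fun n => NilAlg.mk K d (b n)) k := by
  induction k with
  | zero => rfl
  | succ k ih => rw [consecProd, NilAlg.mk_mul, ih, consecProd]

theorem word_consecProd (b : ℕ → FreeSemigroup (Fin d)) (k : ℕ) :
    NilAlg.word K (consecProd b k) = consecProd (fun n => NilAlg.word K (b n)) k := by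
  induction k with
  | zero => rfl
  | succ k ih => rw [consecProd, NilAlg.word_mul, ih, consecProd]

theorem consecProd_mem_lengthGE (b : ℕ → FreeAlg K d) (k : ℕ) :
    consecProd b k ∈ lengthGE K d (k + 1) := by
  induction k with
  | zero => exact mem_lengthGE_one _
  | succ k ih => exact mul_mem_lengthGE ih (mem_lengthGE_one _)

theorem FreeSemigroup.exists_consecProd_eq (w : FreeSemigroup (Fin d)) :
    ∃ (b : ℕ → FreeSemigroup (Fin d)) (k : ℕ), w.length = k + 1 ∧ consecProd b k = w := by
  induction w using FreeSemigroup.recOnMul with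
  | ih1 i => exact ⟨fun _ => FreeSemigroup.of i, 0, rfl, rfl⟩
  | ih2 i w _ ih =>
    obtain ⟨b, k, hk, hb⟩ := ih
    refine ⟨fun n => Nat.casesOn n (FreeSemigroup.of i) b, k + 1, ?_, ?_⟩
    · rw [FreeSemigroup.length_mul, hk, add_comm]
      rfl
    · rw [consecProd_succ_eq_mul]
      exact congrArg _ hb

theorem nilDegree_eq {N : ℕ}
    (hlong : ∀ w : FreeSemigroup (Fin d), N ≤ w.length → NilAlg.word K w = 0)
    {w : FreeSemigroup (Fin d)} (hN : w.length + 1 = N) (hw : NilAlg.word K w ≠ 0) :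
    nilDegree K d = N := by
  obtain ⟨b, k, hk, hb⟩ := w.exists_consecProd_eq
  have hmem : N ∈ {c | ∃ k, c = k + 1 ∧ ∀ a : ℕ → NilAlg K d, consecProd a k = 0} := by
    refine ⟨k + 1, by omega, fun a => ?_⟩
    choose f hf using fun n => NilAlg.mk_surjective K d (a n)
    obtain rfl : (fun n => NilAlg.mk K d (f n)) = a := funext hf
    rw [← mk_consecProd]
    have h := linearCombination_word (consecProd f (k + 1)).coeff
    rw [MonoidAlgebra.ofCoeff_coeff] at h
    rw [← h, Finsupp.linearCombination_apply, Finsupp.sum]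
    refine Finset.sum_eq_zero fun v hv => ?_
    have := consecProd_mem_lengthGE f (k + 1) v (Finsupp.mem_support_iff.1 hv)
    rw [hlong v (by omega), smul_zero]
  refine le_antisymm (csInf_le (OrderBot.bddBelow _) hmem) (le_csInf ⟨N, hmem⟩ ?_)
  rintro _ ⟨m, rfl, hm⟩
  by_contra hlt
  refine hw ?_
  rw [← hb, word_consecProd]
  have hstep : ∀ n, consecProd (fun n => NilAlg.word K (b n)) (m + n) = 0 := by
    intro n
    induction n with
    | zero => exact hm _
    | succ n ih => rw [← add_assoc, consecProd, ih, zero_mul]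
  obtain ⟨n, rfl⟩ : ∃ n, k = m + n := ⟨k - m, by omega⟩
  exact hstep n

/-- A long word that is zero over `L` is zero over `𝔽₂`, since the two ideals differ only in degree
three. -/
theorem NilAlg.word_zmod_eq_zero {L : Type*} [Field L] [Infinite L] [CharP L 2]
    {w : FreeSemigroup (Fin d)} (h3 : 3 < w.length) (hw : NilAlg.word L w = 0) :
    NilAlg.word (ZMod 2) w = 0 := by
  obtain ⟨φ, hφ⟩ := exists_addMonoidHom_one_eq_one L
  have h := NilAlg.mk_eq_zero.1 hw
  rw [← polIdeal_eq_cubeIdeal] at h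
  replace h := coeffMap_mem_polIdeal φ h
  rw [coeffMap_single, hφ] at h
  obtain ⟨u, hu, s, hs, hus⟩ := Submodule.mem_sup.1 (polIdeal_le_cubeIdeal_sup d h)
  obtain ⟨c, rfl⟩ := (Submodule.mem_span_range_iff_exists_fun _).1 hs
  change u + sqPolComb (ZMod 2) c = _ at hus
  have hc : c = 0 := by
    funext p
    have hcoeff : ∀ v : FreeSemigroup (Fin d), v.length = 3 →
        u.coeff v + (sqPolComb (ZMod 2) c).coeff v = 0 := by
      intro v hv
      have hne : v ≠ w := by
        rintro rfl
        omega
      rw [← Finsupp.add_apply, ← MonoidAlgebra.coeff_add, hus, MonoidAlgebra.coeff_single,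
        Finsupp.single_eq_of_ne hne]
    have h₁ := hcoeff _ (length_tripleWord p.1.1 p.1.2 p.1.1)
    have h₂ := hcoeff _ (length_tripleWord p.1.2 p.1.1 p.1.2)
    have h₃ := coeff_sandwich_add_swap hu p.1.1 p.1.2
    rw [coeff_sqPolComb_sandwich] at h₁
    rw [coeff_sqPolComb_swap, add_zero] at h₂
    rw [h₂, add_zero] at h₃
    rwa [h₃, zero_add] at h₁
  rw [NilAlg.word, NilAlg.mk_eq_zero, ← hus, hc]
  simpa [sqPolComb] using hu

/-! ### Dimensions -/

theorem IsWordBasis.finite {B : Set (FreeSemigroup (Fin d))} (hB : IsWordBasis K B) {N : ℕ}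
    (hlong : ∀ w : FreeSemigroup (Fin d), N ≤ w.length → NilAlg.word K w = 0) : B.Finite := by
  refine Set.Finite.of_finite_image (f := FreeSemigroup.toList) ?_
    FreeSemigroup.toList_injective.injOn
  refine (List.finite_length_lt (Fin d) N).subset ?_
  rintro _ ⟨w, hw, rfl⟩
  rw [Set.mem_ofPred_eq, FreeSemigroup.length_toList]
  by_contra! h
  exact hB.1.ne_zero ⟨w, hw⟩ (hlong w h)

theorem IsWordBasis.finrank_eq {B : Set (FreeSemigroup (Fin d))} (hB : IsWordBasis K B) :
    Module.finrank K (NilAlg K d) = B.ncard := by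
  have hspan : ⊤ ≤ Submodule.span K
      (Set.range fun w : B => NilAlg.word K (w : FreeSemigroup (Fin d))) := by
    rw [← hB.2, Set.image_eq_range]
  rw [Module.finrank_eq_nat_card_basis (Module.Basis.mk hB.1 hspan)]
  rfl

theorem IsWordBasis.module_finite {B : Set (FreeSemigroup (Fin d))} (hB : IsWordBasis K B)
    (hfin : B.Finite) : Module.Finite K (NilAlg K d) :=
  ⟨⟨(hfin.image _).toFinset, by rw [Set.Finite.coe_toFinset, hB.2]⟩⟩

theorem sandwichWords_eq_image (d : ℕ) : sandwichWords d =
    ((Finset.univ.filter fun p : Fin d × Fin d => p.1 < p.2).image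
      fun p => tripleWord p.1 p.2 p.1 : Finset (FreeSemigroup (Fin d))) := by
  ext w
  rw [mem_sandwichWords]
  simp [eq_comm]

theorem ncard_sandwichWords (d : ℕ) : (sandwichWords d).ncard = d * (d - 1) / 2 := by
  rw [sandwichWords_eq_image, Set.ncard_coe_finset, Finset.card_image_of_injective]
  · rw [← Finset.sum_range_id, ← Fin.sum_univ_eq_sum_range (fun i => i), Finset.card_filter,
      ← Finset.univ_product_univ, Finset.sum_product_right]
    refine Finset.sum_congr rfl fun j _ => ?_
    rw [← Finset.card_filter, ← Fin.card_Iio j]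
    exact congrArg Finset.card (by ext; simp)
  · intro p q h
    obtain ⟨h₁, h₂, -⟩ := tripleWord_inj.1 h
    exact Prod.ext h₁ h₂

end NilDegree

theorem theorem2 (d : ℕ) (hd : 2 ≤ d) (L : Type*) [Field L] [Infinite L] [CharP L 2] :
    (nilDegree (ZMod 2) d = nilDegree L d ∧
      nilDegree L d = if d = 2 then 6 else d + 3) ∧
    (Module.Finite L (NilAlg L d) ∧ Module.Finite (ZMod 2) (NilAlg (ZMod 2) d) ∧
      Module.finrank (ZMod 2) (NilAlg (ZMod 2) d) =
        Module.finrank L (NilAlg L d) + d * (d - 1) / 2) ∧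
    ((∃ B : Set (FreeSemigroup (Fin d)), IsWordBasis L B ∧ Disjoint B (sandwichWords d)) ∧
      ∀ B : Set (FreeSemigroup (Fin d)), IsWordBasis L B → Disjoint B (sandwichWords d) →
        IsWordBasis (ZMod 2) (B ∪ sandwichWords d)) := by
  have hlong : ∀ w : FreeSemigroup (Fin d), (if d = 2 then 6 else d + 3) ≤ w.length →
      6 ≤ w.length ∧ d + 3 ≤ w.length := by
    intro w hw
    split_ifs at hw <;> omega
  have hL : ∀ w : FreeSemigroup (Fin d), (if d = 2 then 6 else d + 3) ≤ w.length →
      NilAlg.word L w = 0 :=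
    fun w hw => NilAlg.word_eq_zero (hlong w hw).1 (hlong w hw).2
  have hF : ∀ w : FreeSemigroup (Fin d), (if d = 2 then 6 else d + 3) ≤ w.length →
      NilAlg.word (ZMod 2) w = 0 := by
    intro w hw
    have := (hlong w hw).1
    exact NilAlg.word_zmod_eq_zero (by omega) (hL w hw)
  obtain ⟨v, hv, hv0⟩ := exists_nonzero_word d hd L
  obtain ⟨w, hw, hw0⟩ := exists_nonzero_word d hd (ZMod 2)
  have hdegL := nilDegree_eq hL hv hv0
  have hdegF := nilDegree_eq hF hw hw0
  obtain ⟨B, hB, hS⟩ := exists_isWordBasis_disjoint L d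
  have hBS := isWordBasis_union_sandwichWords hB hS
  refine ⟨⟨hdegF.trans hdegL.symm, hdegL⟩, ⟨hB.module_finite (hB.finite hL),
    hBS.module_finite (hBS.finite hF), ?_⟩, ⟨B, hB, hS⟩,
    fun B hB hS => isWordBasis_union_sandwichWords hB hS⟩
  rw [hBS.finrank_eq, hB.finrank_eq, Set.ncard_union_eq hS (hB.finite hL)
    ((hBS.finite hF).subset Set.subset_union_right), ncard_sandwichWords]
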